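/- **The calculus $\lambda_{LAL}^{Reg,\mu}$.** Fix countable sets of variables $x$ and of region names $r$. Values and terms are $$V ::= x \mid \lambda x.M \mid r \mid () \mid \underline{n} \mid\ !V \mid \S V,$$ $$M ::= V \mid M_1M_2 \mid V_1\star V_2 \mid\ !M \mid \S M \mid \mathsf{let}\ !x=V\ \mathsf{in}\ M \mid \mathsf{let}\ \S x=V\ \mathsf{in}\ M \mid \mathsf{get}(r)\mid \mathsf{set}(r,V),$$ up to renaming of bound variables, where $n$ is an integer and $\star$ any binary operation on integers. The depth $d(M)$ is the maximal number of modal constructors $!,\S$ under which an occurrence of $M$ is nested, and $size(M)$ is the number of nodes of the syntax tree of $M$. Below, $\dagger$ stands for $!$ or $\S$. **Machine.** A configuration $\langle M,E,S\rangle$ consists of a term, an environment $E ::= \diamond\mid V\cdot E\mid M\odot E\mid\ !\cdot E\mid \S\cdot E$ and a store $S$, a finite multiset of assignments $r\leftarrow V$. The steps are $\langle \underline{n_1}\star \underline{n_2},E,S\rangle\to\langle \underline{n_1\star n_2},E,S\rangle$; $\langle\lambda x.M,V\cdot E,S\rangle\to\langle M[V/x],E,S\rangle$; $\langle MN,E,S\rangle\to\langle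 N,M\odot E,S\rangle$; $\langle V,M\odot E,S\rangle\to\langle M,V\cdot E,S\rangle$; $\langle\dagger M,E,S\rangle\to\langle M,\dagger\cdot E,S\rangle$ if $M$ is not a value; $\langle V,\dagger\cdot E,S\rangle\to\langle\dagger V,E,S\rangle$; $\langle\mathsf{let}\ \dagger x=\dagger V\ \mathsf{in}\ M,E,S\rangle\to\langle M[V/x],E,S\rangle$; $\langle\mathsf{get}(r),E,\{r\leftarrow V\}\uplus S\rangle\to\langle V,E,S\rangle$; $\langle\mathsf{set}(r,V),E,S\rangle\to\langle (),E,\{r\leftarrow V\}\uplus S\rangle$. A configuration to which no step applies is final. **Types.** $A,B::=X\mid \mathsf{Unit}\mid\mathsf N\mid A\multimap B\mid\ !A\mid\S A\mid\mu X.A\mid \mathsf{Reg}_rA$. A region context $R$ is a finite set of declarations $r:(\delta,A)$, $\delta\in\mathbb N$, for distinct regions. $R\vdash A$ means that every region name occurring in $A$ or in the types of $R$ is declared in $R$, and that every type $\mathsf{Reg}_rB$ occurring there has $B=A_r$, where $r:(\delta_r,A_r)\in R$; $R\vdash$ and $R\vdash\Gamma$ mean the same for, respectively, the types of $R$ alone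 and the types of $R$ and $\Gamma$. A variable context $\Gamma$ is a finite set of declarations $x:(u,A)$, with $u\in\{\lambda,!,\S\}$, for distinct variables. Judgments $R;\Gamma\vdash^\delta M:A$, $\delta\in\mathbb N$, are derived by the following rules, where $\Gamma,\Delta$ denotes the union of contexts without common variables and $-$ is the empty context: * if $R\vdash$: $R;-\vdash^\delta\underline n:\mathsf N$; $R;-\vdash^\delta():\mathsf{Unit}$; $R;x:(\lambda,A)\vdash^\delta x:A$; and $R;-\vdash^\delta r:\mathsf{Reg}_rA$ when $r:(\delta,A)\in R$; * from $R;\Gamma\vdash^\delta V_1:\mathsf N$ and $R;\Delta\vdash^\delta V_2:\mathsf N$ infer $R;\Gamma,\Delta\vdash^\delta V_1\star V_2:\mathsf N$; * contraction: from $R;\Gamma,x:(!,A),y:(!,A)\vdash^\delta M:B$ infer $R;\Gamma,z:(!,A)\vdash^\delta M[z/x,z/y]:B$; * weakening: from $R;\Gamma\vdash^\delta M:B$ and $R\vdash\Gamma,x:(u,A)$ infer $R;\Gamma,x:(u,A)\vdash^\delta M:B$; * from $R;\Gamma,x:(\lambda,A)\vdash^\delta M:B$ infer $R;\Gamma\vdash^\delta\lambda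 x.M:A\multimap B$; from $R;\Gamma\vdash^\delta M_1:A\multimap B$ and $R;\Delta\vdash^\delta M_2:A$ infer $R;\Gamma,\Delta\vdash^\delta M_1M_2:B$; * $!$-promotion, for a value $V$: from $R;x:(\lambda,A)\vdash^\delta V:B$ infer $R;x:(!,A)\vdash^{\delta+1}\,!V:\,!B$, and from $R;-\vdash^\delta V:B$ infer $R;-\vdash^{\delta+1}\,!V:\,!B$; * $\S$-promotion: from $R;\Gamma\vdash^\delta M:A$, where all usages in $\Gamma$ are $\lambda$, infer $R;\Gamma'\vdash^{\delta+1}\S M:\S A$, where $\Gamma'$ is $\Gamma$ with each usage replaced by $\S$ or by $!$; * from $R;\Gamma\vdash^\delta V:\dagger A$ and $R;\Delta,x:(\dagger,A)\vdash^\delta M:B$ infer $R;\Gamma,\Delta\vdash^\delta\mathsf{let}\ \dagger x=V\ \mathsf{in}\ M:B$; * from $R;-\vdash^\delta r:\mathsf{Reg}_rA$ infer $R;-\vdash^\delta\mathsf{get}(r):A$; if moreover $R;\Gamma\vdash^\delta V:A$, infer $R;\Gamma\vdash^\delta\mathsf{set}(r,V):\mathsf{Unit}$; * from $R;\Gamma\vdash^\delta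 M:\mu X.A$ infer $R;\Gamma\vdash^\delta M:A[\mu X.A/X]$, and conversely. A term $M$ is *well-typed* if $R;\Gamma\vdash^\delta M:A$ is derivable for some $R,\Gamma,\delta,A$ such that every type declared in $R$ has the form $\S B$, and for every type $\mu X.B$ occurring in $R$ or $\Gamma$ all occurrences of $X$ in $B$ are under a modality $!$ or $\S$. **Theorem (Polynomial termination).** There is a family of polynomials $\{P_d\}_{d\in\mathbb N}$ such that for every well-typed term $M$ the machine started from $\langle M,\diamond,\diamond\rangle$ (empty environment and empty store) terminates within $P_{d(M)}(size(M))$ steps: every run from this configuration has at most that many steps (whichever stored values are read), and so a final configuration is reached. -/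

import Mathlib

namespace LALReg

/-- Region names (a countable set). -/
abbrev Region : Type := ℕ

/-- The two modalities `!` (bang) and `§` (paragraph). -/
inductive Modality : Type
  | bang
  | para

/-! ## Types -/

/-- Types; the variable bound by `μ` is a de Bruijn index.
`mod .bang A` is `!A`, `mod .para A` is `§A`, `reg r A` is `Reg_r A`. -/
inductive Ty : Type
  | tvar (n : ℕ)
  | unit
  | num
  | arrow (A B : Ty)
  | mod (m : Modality) (A : Ty)
  | mu (A : Ty)
  | reg (r : Region) (A : Ty)

namespace Ty

/-- Lifting of a renaming of indices under one binder. -/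
def liftRen (ρ : ℕ → ℕ) : ℕ → ℕ
  | 0 => 0
  | n + 1 => ρ n + 1

/-- Renaming of type variables. -/
def rename : (ℕ → ℕ) → Ty → Ty
  | ρ, tvar n => tvar (ρ n)
  | _, unit => unit
  | _, num => num
  | ρ, arrow A B => arrow (rename ρ A) (rename ρ B)
  | ρ, mod m A => mod m (rename ρ A)
  | ρ, mu A => mu (rename (liftRen ρ) A)
  | ρ, reg r A => reg r (rename ρ A)

/-- Lifting of a substitution under one binder. -/
def liftSub (σ : ℕ → Ty) : ℕ → Ty
  | 0 => tvar 0
  | n + 1 => rename Nat.succ (σ n)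

/-- Capture-avoiding parallel substitution of types for type variables. -/
def subst : (ℕ → Ty) → Ty → Ty
  | σ, tvar n => σ n
  | _, unit => unit
  | _, num => num
  | σ, arrow A B => arrow (subst σ A) (subst σ B)
  | σ, mod m A => mod m (subst σ A)
  | σ, mu A => mu (subst (liftSub σ) A)
  | σ, reg r A => reg r (subst σ A)

/-- The substitution sending the variable `0` to `B` and lowering the others. -/
def single (B : Ty) : ℕ → Ty
  | 0 => B
  | n + 1 => tvar n

/-- The unfolding `A[μX.A/X]` of `μX.A`. -/
def unfold (A : Ty) : Ty := subst (single (mu A)) A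

/-- Every occurrence of the type variable `k` in the type is under a modality. -/
def GuardedVar : ℕ → Ty → Prop
  | k, tvar n => n ≠ k
  | _, unit => True
  | _, num => True
  | k, arrow A B => GuardedVar k A ∧ GuardedVar k B
  | _, mod _ _ => True
  | k, mu A => GuardedVar (k + 1) A
  | k, reg _ A => GuardedVar k A

/-- For every fixpoint `μX.A` occurring in the type, all occurrences of `X` in `A` are guarded
by a modality. -/
def FixGuarded : Ty → Prop
  | tvar _ => True
  | unit => True
  | num => True
  | arrow A B => FixGuarded A ∧ FixGuarded B
  | mod _ A => FixGuarded A
  | mu A => GuardedVar 0 A ∧ FixGuarded A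
  | reg _ A => FixGuarded A

end Ty

/-! ## Terms -/

/-- Terms up to renaming of bound variables (de Bruijn indices).
`arith op V W` is `V ⋆ W` for the binary operation `op`; `regc r` is the region constant `r`;
`mod m M` is `!M` or `§M`; `lett m V M` is `let m x = V in M`, binding one variable in `M`.
The restriction of some positions to values is part of the typing rules. -/
inductive Tm : Type
  | var (x : ℕ)
  | lam (M : Tm)
  | regc (r : Region)
  | unit
  | int (n : ℤ)
  | app (M N : Tm)
  | arith (op : ℤ → ℤ → ℤ) (V W : Tm)
  | mod (m : Modality) (M : Tm)
  | lett (m : Modality) (V M : Tm)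
  | get (r : Region)
  | set (r : Region) (V : Tm)

namespace Tm

/-- Values: `V ::= x | λx.M | r | () | n | !V | §V`. -/
inductive IsValue : Tm → Prop
  | var (x : ℕ) : IsValue (var x)
  | lam (M : Tm) : IsValue (lam M)
  | regc (r : Region) : IsValue (regc r)
  | unit : IsValue unit
  | int (n : ℤ) : IsValue (int n)
  | mod (m : Modality) {V : Tm} : IsValue V → IsValue (mod m V)

/-- Lifting of a renaming of indices under one binder. -/
def liftRen (ρ : ℕ → ℕ) : ℕ → ℕ
  | 0 => 0
  | n + 1 => ρ n + 1

/-- Renaming of free variables. -/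
def rename : (ℕ → ℕ) → Tm → Tm
  | ρ, var x => var (ρ x)
  | ρ, lam M => lam (rename (liftRen ρ) M)
  | _, regc r => regc r
  | _, unit => unit
  | _, int n => int n
  | ρ, app M N => app (rename ρ M) (rename ρ N)
  | ρ, arith op V W => arith op (rename ρ V) (rename ρ W)
  | ρ, mod m M => mod m (rename ρ M)
  | ρ, lett m V M => lett m (rename ρ V) (rename (liftRen ρ) M)
  | _, get r => get r
  | ρ, set r V => set r (rename ρ V)

/-- Lifting of a substitution under one binder. -/
def liftSub (σ : ℕ → Tm) : ℕ → Tm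
  | 0 => var 0
  | n + 1 => rename Nat.succ (σ n)

/-- Capture-avoiding parallel substitution. -/
def subst : (ℕ → Tm) → Tm → Tm
  | σ, var x => σ x
  | σ, lam M => lam (subst (liftSub σ) M)
  | _, regc r => regc r
  | _, unit => unit
  | _, int n => int n
  | σ, app M N => app (subst σ M) (subst σ N)
  | σ, arith op V W => arith op (subst σ V) (subst σ W)
  | σ, mod m M => mod m (subst σ M)
  | σ, lett m V M => lett m (subst σ V) (subst (liftSub σ) M)
  | _, get r => get r
  | σ, set r V => set r (subst σ V)

/-- The substitution sending the variable `0` to `V` and lowering the others. -/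
def single (V : Tm) : ℕ → Tm
  | 0 => V
  | n + 1 => var n

/-- `M[V/x]`, for the variable `x` bound by the innermost binder around `M`. -/
def inst (M V : Tm) : Tm := subst (single V) M

/-- The size of a term: the number of its occurrences (nodes of the syntax tree). -/
def size : Tm → ℕ
  | var _ => 1
  | lam M => size M + 1
  | regc _ => 1
  | unit => 1
  | int _ => 1
  | app M N => size M + size N + 1
  | arith _ V W => size V + size W + 1
  | mod _ M => size M + 1
  | lett _ V M => size V + size M + 1
  | get _ => 1
  | set _ V => size V + 1

/-- The depth of a term: the maximal number of nested modal constructors above an occurrence. -/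
def depth : Tm → ℕ
  | var _ => 0
  | lam M => depth M
  | regc _ => 0
  | unit => 0
  | int _ => 0
  | app M N => max (depth M) (depth N)
  | arith _ V W => max (depth V) (depth W)
  | mod _ M => depth M + 1
  | lett _ V M => max (depth V) (depth M)
  | get _ => 0
  | set _ V => depth V

end Tm

/-! ## The abstract machine -/

/-- Frames of an environment: `V ·` (`arg V`), `M ⊙` (`fn M`), and `! ·` or `§ ·` (`mod m`). -/
inductive Frame : Type
  | arg (V : Tm)
  | fn (M : Tm)
  | mod (m : Modality)

/-- Environments; `[]` is the empty frame `⋄`. -/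
abbrev Env : Type := List Frame

/-- Stores: finite multisets of region assignments `r ← V`. -/
abbrev Store : Type := Multiset (Region × Tm)

/-- Configurations `⟨M, E, S⟩`. -/
structure Conf : Type where
  term : Tm
  env : Env
  store : Store

/-- The initial configuration `⟨M, ⋄, ⋄⟩`: empty environment and empty store. -/
def Conf.init (M : Tm) : Conf := ⟨M, [], 0⟩

/-- One step of the machine. Reading a region consumes one of its values (any of them), and
writing adds a value. -/
inductive Step : Conf → Conf → Prop
  | arith (op : ℤ → ℤ → ℤ) (a b : ℤ) (E : Env) (S : Store) :
      Step ⟨.arith op (.int a) (.int b), E, S⟩ ⟨.int (op a b), E, S⟩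
  | beta (M V : Tm) (E : Env) (S : Store) : V.IsValue →
      Step ⟨.lam M, .arg V :: E, S⟩ ⟨M.inst V, E, S⟩
  | app (M N : Tm) (E : Env) (S : Store) :
      Step ⟨.app M N, E, S⟩ ⟨N, .fn M :: E, S⟩
  | swap (V M : Tm) (E : Env) (S : Store) : V.IsValue →
      Step ⟨V, .fn M :: E, S⟩ ⟨M, .arg V :: E, S⟩
  | enter (m : Modality) (M : Tm) (E : Env) (S : Store) : ¬ M.IsValue →
      Step ⟨.mod m M, E, S⟩ ⟨M, .mod m :: E, S⟩
  | leave (m : Modality) (V : Tm) (E : Env) (S : Store) : V.IsValue →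
      Step ⟨V, .mod m :: E, S⟩ ⟨.mod m V, E, S⟩
  | lett (m : Modality) (V M : Tm) (E : Env) (S : Store) : V.IsValue →
      Step ⟨.lett m (.mod m V) M, E, S⟩ ⟨M.inst V, E, S⟩
  | get (r : Region) (V : Tm) (E : Env) (S : Store) :
      Step ⟨.get r, E, (r, V) ::ₘ S⟩ ⟨V, E, S⟩
  | set (r : Region) (V : Tm) (E : Env) (S : Store) : V.IsValue →
      Step ⟨.set r V, E, S⟩ ⟨.unit, E, (r, V) ::ₘ S⟩

/-- `Steps n C C'`: the machine can go from `C` to `C'` in exactly `n` steps. -/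
inductive Steps : ℕ → Conf → Conf → Prop
  | refl (C : Conf) : Steps 0 C C
  | head {n : ℕ} {C C' C'' : Conf} : Step C C' → Steps n C' C'' → Steps (n + 1) C C''

/-- No rule of the machine applies. -/
def Conf.IsFinal (C : Conf) : Prop := ∀ C', ¬ Step C C'

/-- `C` terminates in at most `N` steps: whatever values are read from the store, no run from `C`
is longer than `N` steps, and some run ends in a final configuration. -/
def TerminatesWithin (C : Conf) (N : ℕ) : Prop :=
  (∀ (n : ℕ) (C' : Conf), Steps n C C' → n ≤ N) ∧
    ∃ (n : ℕ) (C' : Conf), Steps n C C' ∧ C'.IsFinal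

/-! ## The type system -/

/-- Usages `λ`, `§`, `!` of variables. -/
inductive Usage : Type
  | lam
  | mod (m : Modality)

/-- Variable contexts: partial maps from (free) variables to usages and types. Every context of
a derivable judgment is finite, because the typing rules only build finite ones. -/
abbrev Ctx : Type := ℕ → Option (Usage × Ty)

namespace Ctx

/-- The empty context. -/
def empty : Ctx := fun _ => none

/-- `Γ, x : (u, A)` for a variable `x` that is not in `Γ`. -/
def insert (Γ : Ctx) (x : ℕ) (u : Usage) (A : Ty) : Ctx := Function.update Γ x (some (u, A))

/-- The context `Γ, x : (u, A)` under a binder of `x`, which becomes the variable `0`. -/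
def cons (u : Usage) (A : Ty) (Γ : Ctx) : Ctx
  | 0 => some (u, A)
  | n + 1 => Γ n

/-- The two contexts have no variable in common. -/
def Disjoint (Γ Δ : Ctx) : Prop := ∀ x, Γ x = none ∨ Δ x = none

/-- `Γ, Δ` for disjoint contexts. -/
def union (Γ Δ : Ctx) : Ctx := fun x => (Γ x).or (Δ x)

/-- All variables of `Γ` have usage `λ`, and `Γ'` arises from `Γ` by giving each of them one
of the usages `§`, `!`. -/
def Promotes (Γ Γ' : Ctx) : Prop :=
  ∀ x, (Γ x = none ∧ Γ' x = none) ∨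
    ∃ (A : Ty) (m : Modality), Γ x = some (.lam, A) ∧ Γ' x = some (.mod m, A)

end Ctx

/-- Region contexts: `R r = some (δ, A)` means that `r : (δ, A)` is in `R`. -/
abbrev RegCtx : Type := Region → Option (ℕ × Ty)

/-- Each region name occurring in the type belongs to `R`, and each subexpression `Reg_r B` has
`B = A` where `r : (δ, A)` is in `R`. The number `k` counts the binders `μ` that have been
crossed: below them `A` is the type of `R` with its indices raised by `k`. -/
def RegOK (R : RegCtx) : ℕ → Ty → Prop
  | _, .tvar _ => True
  | _, .unit => True
  | _, .num => True
  | k, .arrow A B => RegOK R k A ∧ RegOK R k B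
  | k, .mod _ A => RegOK R k A
  | k, .mu A => RegOK R (k + 1) A
  | k, .reg r B =>
      (∃ (δ : ℕ) (A : Ty), R r = some (δ, A) ∧ B = A.rename (fun n => n + k)) ∧ RegOK R k B

/-- `R ⊢`. -/
def RegCtx.WF (R : RegCtx) : Prop := ∀ (r : Region) (δ : ℕ) (A : Ty), R r = some (δ, A) → RegOK R 0 A

/-- `R ⊢ A`. -/
def RegCtx.WFTy (R : RegCtx) (A : Ty) : Prop := R.WF ∧ RegOK R 0 A

/-- `R ⊢ Γ`. -/
def RegCtx.WFCtx (R : RegCtx) (Γ : Ctx) : Prop :=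
  R.WF ∧ ∀ (x : ℕ) (u : Usage) (A : Ty), Γ x = some (u, A) → R.WFTy A

/-- The renaming that sends `x` and `y` to `z`. -/
def contractRen (x y z : ℕ) : ℕ → ℕ := fun i => if i = x ∨ i = y then z else i

/-- The typing judgment `R; Γ ⊢^δ M : A`. All depth indices are natural numbers. -/
inductive HasType (R : RegCtx) : Ctx → ℕ → Tm → Ty → Prop
  | int (δ : ℕ) (n : ℤ) : R.WF → HasType R .empty δ (.int n) .num
  | arith {Γ Δ : Ctx} {δ : ℕ} {V W : Tm} (op : ℤ → ℤ → ℤ) : Γ.Disjoint Δ →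
      V.IsValue → W.IsValue → HasType R Γ δ V .num → HasType R Δ δ W .num →
      HasType R (Γ.union Δ) δ (.arith op V W) .num
  | var (δ x : ℕ) (A : Ty) : R.WF → HasType R (Ctx.empty.insert x .lam A) δ (.var x) A
  | unit (δ : ℕ) : R.WF → HasType R .empty δ .unit .unit
  | regc {δ : ℕ} {r : Region} {A : Ty} : R.WF → R r = some (δ, A) →
      HasType R .empty δ (.regc r) (.reg r A)
  | contr {Γ : Ctx} {δ : ℕ} {M : Tm} {A B : Ty} {x y z : ℕ} :
      Γ x = none → Γ y = none → Γ z = none → x ≠ y →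
      HasType R ((Γ.insert x (.mod .bang) A).insert y (.mod .bang) A) δ M B →
      HasType R (Γ.insert z (.mod .bang) A) δ (M.rename (contractRen x y z)) B
  | weak {Γ : Ctx} {δ : ℕ} {M : Tm} {A B : Ty} {x : ℕ} {u : Usage} :
      Γ x = none → HasType R Γ δ M B → R.WFCtx (Γ.insert x u A) →
      HasType R (Γ.insert x u A) δ M B
  | lam {Γ : Ctx} {δ : ℕ} {M : Tm} {A B : Ty} :
      HasType R (Γ.cons .lam A) δ M B → HasType R Γ δ (.lam M) (.arrow A B)
  | app {Γ Δ : Ctx} {δ : ℕ} {M N : Tm} {A B : Ty} : Γ.Disjoint Δ →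
      HasType R Γ δ M (.arrow A B) → HasType R Δ δ N A →
      HasType R (Γ.union Δ) δ (.app M N) B
  | bangProm {x δ : ℕ} {V : Tm} {A B : Ty} : V.IsValue →
      HasType R (Ctx.empty.insert x .lam A) δ V B →
      HasType R (Ctx.empty.insert x (.mod .bang) A) (δ + 1) (.mod .bang V) (.mod .bang B)
  | bangPromClosed {δ : ℕ} {V : Tm} {B : Ty} : V.IsValue →
      HasType R .empty δ V B →
      HasType R .empty (δ + 1) (.mod .bang V) (.mod .bang B)
  | paraProm {Γ Γ' : Ctx} {δ : ℕ} {M : Tm} {A : Ty} : Γ.Promotes Γ' →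
      HasType R Γ δ M A → HasType R Γ' (δ + 1) (.mod .para M) (.mod .para A)
  | lett {Γ Δ : Ctx} {δ : ℕ} {V M : Tm} {A B : Ty} (m : Modality) : Γ.Disjoint Δ →
      V.IsValue → HasType R Γ δ V (.mod m A) → HasType R (Δ.cons (.mod m) A) δ M B →
      HasType R (Γ.union Δ) δ (.lett m V M) B
  | get {δ : ℕ} {r : Region} {A : Ty} :
      HasType R .empty δ (.regc r) (.reg r A) → HasType R .empty δ (.get r) A
  | set {Γ : Ctx} {δ : ℕ} {r : Region} {V : Tm} {A : Ty} :
      HasType R .empty δ (.regc r) (.reg r A) → V.IsValue → HasType R Γ δ V A →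
      HasType R Γ δ (.set r V) .unit
  | unfold {Γ : Ctx} {δ : ℕ} {M : Tm} {A : Ty} :
      HasType R Γ δ M (.mu A) → HasType R Γ δ M A.unfold
  | fold {Γ : Ctx} {δ : ℕ} {M : Tm} {A : Ty} :
      HasType R Γ δ M A.unfold → HasType R Γ δ M (.mu A)

/-- `M` is well-typed: some `R; Γ ⊢^δ M : A` with `R` finite is derivable, all regions hold
values of types of the form `§B`, and all type fixpoints in `R` and `Γ` are guarded. -/
def WellTyped (M : Tm) : Prop :=
  ∃ (R : RegCtx) (Γ : Ctx) (δ : ℕ) (A : Ty),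
    {r : Region | R r ≠ none}.Finite ∧
    HasType R Γ δ M A ∧
    (∀ (r : Region) (δ' : ℕ) (B : Ty), R r = some (δ', B) → ∃ C : Ty, B = .mod .para C) ∧
    (∀ (r : Region) (δ' : ℕ) (B : Ty), R r = some (δ', B) → B.FixGuarded) ∧
    (∀ (x : ℕ) (u : Usage) (B : Ty), Γ x = some (u, B) → B.FixGuarded)

end LALReg

/-! The proof attaches to each configuration a natural-number potential that every machine step
strictly decreases. Types serve only to extract, by `HasType.stratified`, a syntactic discipline on
the positions and multiplicities of bound variables. `Step.weight_lt` preserves this discipline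
directly, so no subject reduction is needed.

The level of a subterm is the number of modalities above it, and an active node at level `δ` costs a
multiple of `node δ`. A `λ`- or `let §`-bound variable occurs at most once and at a known level, so
its substitution copies no potential. The difficulty is `let !x = !V in M`, which duplicates `V`.
Each occurrence of such an `x` outside `!`-boxes is charged `node δ` in advance, with `δ` the level
of the `let`. A box `!W` containing `x` is charged `box δ` times the potential of `W`; once `x` has
been instantiated, the box costs nothing.

Prepayment suffices if box contents never weigh more than `node δ`. The invariant `BoxBound` ensures
this: for every box without marked variables, `box δ` times the potential of its contents, plus the
potential of the whole configuration, is at most a constant `Z`. Filling `!W` with `V` adds the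
potential of `V`, already bounded in this way, to that of `W`, whose multiple by `box δ` has just
left the total (`Stratified.subst_box`). With `Z = box δ * node δ` the invariant gives the required
bound.

For size `s`, depth `d` and `a = 6 * s`, the choice `node i = a ^ (2 ^ d - 2 ^ i)`, `box i = a ^ 2 ^
i` makes the invariant hold initially. The initial potential, hence the length of any run, is at
most `a ^ 2 ^ d`. -/

namespace LALReg

/-! ### Counting and locating variable occurrences under renaming and substitution -/

/-- Extension of a family of marks by a mark for the new variable `0`. -/
def consMark (n : ℕ) (b : ℕ → ℕ) : ℕ → ℕ
  | 0 => n
  | x + 1 => b x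

@[simp] theorem consMark_zero (n : ℕ) (b : ℕ → ℕ) : consMark n b 0 = n := rfl

@[simp] theorem consMark_succ (n : ℕ) (b : ℕ → ℕ) (x : ℕ) : consMark n b (x + 1) = b x := rfl

@[simp] theorem consMark_const_zero : consMark 0 (fun _ => 0) = fun _ => 0 := by
  funext x; cases x <;> rfl

theorem consMark_comp_liftRen (n : ℕ) (b : ℕ → ℕ) (ρ : ℕ → ℕ) :
    (fun x => consMark n b (Tm.liftRen ρ x)) = consMark n (fun x => b (ρ x)) := by
  funext x; cases x <;> rfl

namespace Tm

/-- The marks of the free variable occurrences, added up. -/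
def count : (ℕ → ℕ) → Tm → ℕ
  | b, var x => b x
  | b, lam M => count (consMark 0 b) M
  | _, regc _ => 0
  | _, unit => 0
  | _, int _ => 0
  | b, app M N => count b M + count b N
  | b, arith _ V W => count b V + count b W
  | b, mod _ M => count b M
  | b, lett _ V M => count b V + count (consMark 0 b) M
  | _, get _ => 0
  | b, set _ V => count b V

/-- Extension under a binder of a condition on free occurrences. -/
def liftOcc (P : List Modality → ℕ → Prop) : List Modality → ℕ → Prop
  | _, 0 => True
  | p, x + 1 => P p x

/-- Every free occurrence of a variable `x`, below the sequence `p` of modalities (outermost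
first), satisfies `P p x`. -/
def AllOcc : (List Modality → ℕ → Prop) → Tm → Prop
  | P, var x => P [] x
  | P, lam M => AllOcc (liftOcc P) M
  | _, regc _ => True
  | _, unit => True
  | _, int _ => True
  | P, app M N => AllOcc P M ∧ AllOcc P N
  | P, arith _ V W => AllOcc P V ∧ AllOcc P W
  | P, mod m M => AllOcc (fun p => P (m :: p)) M
  | P, lett _ V M => AllOcc P V ∧ AllOcc (liftOcc P) M
  | _, get _ => True
  | P, set _ V => AllOcc P V

theorem liftRen_comp (ρ ρ' : ℕ → ℕ) :
    (fun x => liftRen ρ (liftRen ρ' x)) = liftRen (fun x => ρ (ρ' x)) := by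
  funext x; cases x <;> rfl

theorem liftRen_id : liftRen (fun x => x) = fun x => x := by
  funext x; cases x <;> rfl

theorem rename_rename (ρ ρ' : ℕ → ℕ) (M : Tm) :
    (M.rename ρ').rename ρ = M.rename (fun x => ρ (ρ' x)) := by
  induction M generalizing ρ ρ' <;> simp_all [rename, liftRen_comp]

theorem rename_id (M : Tm) : M.rename (fun x => x) = M := by
  induction M <;> simp_all [rename, liftRen_id]

theorem depth_rename (ρ : ℕ → ℕ) (M : Tm) : (M.rename ρ).depth = M.depth := by
  induction M generalizing ρ <;> simp_all [rename, depth]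

theorem size_pos (M : Tm) : 1 ≤ M.size := by
  cases M <;> simp [size]

theorem isValue_mod {m : Modality} {M : Tm} : (mod m M).IsValue ↔ M.IsValue :=
  ⟨fun h => by cases h; assumption, fun h => .mod m h⟩

theorem isValue_subst {σ : ℕ → Tm} (hσ : ∀ x, (σ x).IsValue) (M : Tm) :
    (M.subst σ).IsValue ↔ M.IsValue := by
  induction M generalizing σ with
  | var x => exact ⟨fun _ => .var x, fun _ => hσ x⟩
  | mod m M ih => rw [subst, isValue_mod, isValue_mod, ih hσ]
  | lam M => exact ⟨fun _ => .lam _, fun _ => .lam _⟩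
  | regc r => rfl
  | unit => rfl
  | int => rfl
  | app | arith | lett | get | set => exact ⟨nofun, nofun⟩

theorem isValue_rename (ρ : ℕ → ℕ) (M : Tm) : (M.rename ρ).IsValue ↔ M.IsValue := by
  induction M generalizing ρ with
  | var x => exact ⟨fun _ => .var x, fun _ => .var _⟩
  | mod m M ih => rw [rename, isValue_mod, isValue_mod, ih]
  | lam M => exact ⟨fun _ => .lam _, fun _ => .lam _⟩
  | regc r => rfl
  | unit => rfl
  | int => rfl
  | app | arith | lett | get | set => exact ⟨nofun, nofun⟩

theorem count_zero (M : Tm) : M.count (fun _ => 0) = 0 := by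
  induction M <;> simp_all [count]

theorem count_add (b b' : ℕ → ℕ) (M : Tm) :
    M.count (fun x => b x + b' x) = M.count b + M.count b' := by
  have key : ∀ b b' : ℕ → ℕ, consMark 0 (fun x => b x + b' x) =
      fun x => consMark 0 b x + consMark 0 b' x := by
    intro b b'; funext x; cases x <;> rfl
  induction M generalizing b b' <;> simp_all [count] <;> omega

theorem count_mul (n : ℕ) (b : ℕ → ℕ) (M : Tm) :
    M.count (fun x => n * b x) = n * M.count b := by
  have key : ∀ b : ℕ → ℕ, consMark 0 (fun x => n * b x) = fun x => n * consMark 0 b x := by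
    intro b; funext x; cases x <;> rfl
  induction M generalizing b <;> simp_all [count, mul_add]

theorem count_rename (b : ℕ → ℕ) (ρ : ℕ → ℕ) (M : Tm) :
    (M.rename ρ).count b = M.count (fun x => b (ρ x)) := by
  induction M generalizing b ρ <;> simp_all [count, rename, consMark_comp_liftRen]

theorem count_subst (b : ℕ → ℕ) (σ : ℕ → Tm) (M : Tm) :
    (M.subst σ).count b = M.count (fun x => (σ x).count b) := by
  have key : ∀ (b : ℕ → ℕ) (σ : ℕ → Tm),
      (fun x => (liftSub σ x).count (consMark 0 b)) = consMark 0 (fun x => (σ x).count b) := by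
    intro b σ; funext x; cases x
    · rfl
    · simp [liftSub, count_rename]
  induction M generalizing b σ <;> simp_all [count, subst]

theorem AllOcc.mono {P Q : List Modality → ℕ → Prop} {M : Tm} (h : M.AllOcc P)
    (hPQ : ∀ p x, P p x → Q p x) : M.AllOcc Q := by
  have key : ∀ P Q : List Modality → ℕ → Prop, (∀ p x, P p x → Q p x) →
      ∀ p x, liftOcc P p x → liftOcc Q p x := by
    intro P Q h p x; cases x
    · exact id
    · exact h p _
  induction M generalizing P Q with
  | var x => exact hPQ _ _ h
  | lam M ih => exact ih h (key _ _ hPQ)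
  | mod m M ih => exact ih h (fun p x => hPQ _ _)
  | app M N ih₁ ih₂ => exact ⟨ih₁ h.1 hPQ, ih₂ h.2 hPQ⟩
  | arith _ M N ih₁ ih₂ => exact ⟨ih₁ h.1 hPQ, ih₂ h.2 hPQ⟩
  | lett m V M ih₁ ih₂ => exact ⟨ih₁ h.1 hPQ, ih₂ h.2 (key _ _ hPQ)⟩
  | set r V ih => exact ih h hPQ
  | regc | unit | int | get => trivial

theorem AllOcc.and {P Q : List Modality → ℕ → Prop} {M : Tm} (h : M.AllOcc P)
    (h' : M.AllOcc Q) : M.AllOcc (fun p x => P p x ∧ Q p x) := by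
  have key : ∀ P Q : List Modality → ℕ → Prop, ∀ p x, (liftOcc P p x ∧ liftOcc Q p x) →
      liftOcc (fun p x => P p x ∧ Q p x) p x := by
    intro P Q p x; cases x
    · exact fun _ => trivial
    · exact id
  induction M generalizing P Q with
  | var x => exact ⟨h, h'⟩
  | lam M ih => exact (ih h h').mono (key P Q)
  | mod m M ih => exact ih h h'
  | app M N ih₁ ih₂ => exact ⟨ih₁ h.1 h'.1, ih₂ h.2 h'.2⟩
  | arith _ M N ih₁ ih₂ => exact ⟨ih₁ h.1 h'.1, ih₂ h.2 h'.2⟩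
  | lett m V M ih₁ ih₂ => exact ⟨ih₁ h.1 h'.1, (ih₂ h.2 h'.2).mono (key P Q)⟩
  | set r V ih => exact ih h h'
  | regc | unit | int | get => trivial

theorem allOcc_of_forall {P : List Modality → ℕ → Prop} (hP : ∀ p x, P p x) (M : Tm) :
    M.AllOcc P := by
  have key : ∀ P : List Modality → ℕ → Prop, (∀ p x, P p x) → ∀ p x, liftOcc P p x := by
    intro P h p x; cases x
    · trivial
    · exact h p _
  induction M generalizing P with
  | var x => exact hP _ _
  | lam M ih => exact ih (key _ hP)
  | mod m M ih => exact ih (fun p x => hP _ _)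
  | app M N ih₁ ih₂ => exact ⟨ih₁ hP, ih₂ hP⟩
  | arith _ M N ih₁ ih₂ => exact ⟨ih₁ hP, ih₂ hP⟩
  | lett m V M ih₁ ih₂ => exact ⟨ih₁ hP, ih₂ (key _ hP)⟩
  | set r V ih => exact ih hP
  | regc | unit | int | get => trivial

theorem AllOcc.rename {P : List Modality → ℕ → Prop} {ρ : ℕ → ℕ} {M : Tm}
    (h : M.AllOcc (fun p x => P p (ρ x))) : (M.rename ρ).AllOcc P := by
  have key : ∀ (P : List Modality → ℕ → Prop) (ρ : ℕ → ℕ) p x,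
      liftOcc (fun p x => P p (ρ x)) p x → liftOcc P p (liftRen ρ x) := by
    intro P ρ p x; cases x <;> exact id
  induction M generalizing P ρ with
  | var x => exact h
  | lam M ih => exact ih (AllOcc.mono h (key P ρ))
  | mod m M ih => exact ih h
  | app M N ih₁ ih₂ => exact ⟨ih₁ h.1, ih₂ h.2⟩
  | arith _ M N ih₁ ih₂ => exact ⟨ih₁ h.1, ih₂ h.2⟩
  | lett m V M ih₁ ih₂ => exact ⟨ih₁ h.1, ih₂ (h.2.mono (key P ρ))⟩
  | set r V ih => exact ih h
  | regc | unit | int | get => trivial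

/-- An occurrence in the result arises from an occurrence in some `σ x`, so its path is the path to
`x` followed by the path inside `σ x`. -/
theorem AllOcc.subst {P : List Modality → ℕ → Prop} {σ : ℕ → Tm} {M : Tm}
    (h : M.AllOcc (fun p x => (σ x).AllOcc (fun q y => P (p ++ q) y))) : (M.subst σ).AllOcc P := by
  have key : ∀ (P : List Modality → ℕ → Prop) (σ : ℕ → Tm) p x,
      liftOcc (fun p x => (σ x).AllOcc (fun q y => P (p ++ q) y)) p x →
      (liftSub σ x).AllOcc (fun q y => liftOcc P (p ++ q) y) := by
    intro P σ p x; cases x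
    · exact fun _ => trivial
    · exact fun h => AllOcc.rename h
  induction M generalizing P σ with
  | var x => exact h
  | lam M ih => exact ih (AllOcc.mono h (key P σ))
  | mod m M ih => exact ih h
  | app M N ih₁ ih₂ => exact ⟨ih₁ h.1, ih₂ h.2⟩
  | arith _ M N ih₁ ih₂ => exact ⟨ih₁ h.1, ih₂ h.2⟩
  | lett m V M ih₁ ih₂ => exact ⟨ih₁ h.1, ih₂ (h.2.mono (key P σ))⟩
  | set r V ih => exact ih h
  | regc | unit | int | get => trivial

theorem count_congr {b b' : ℕ → ℕ} {M : Tm} (h : M.AllOcc (fun _ x => b x = b' x)) :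
    M.count b = M.count b' := by
  have key : ∀ (b b' : ℕ → ℕ) (p : List Modality) x, liftOcc (fun _ x => b x = b' x) p x →
      consMark 0 b x = consMark 0 b' x := by
    intro b b' p x; cases x
    · exact fun _ => rfl
    · exact id
  induction M generalizing b b' with
  | var x => exact h
  | lam M ih => exact ih (AllOcc.mono h (key b b'))
  | mod m M ih => exact ih h
  | app M N ih₁ ih₂ => exact congrArg₂ (· + ·) (ih₁ h.1) (ih₂ h.2)
  | arith _ M N ih₁ ih₂ => exact congrArg₂ (· + ·) (ih₁ h.1) (ih₂ h.2)
  | lett m V M ih₁ ih₂ => exact congrArg₂ (· + ·) (ih₁ h.1) (ih₂ (h.2.mono (key b b')))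
  | set r V ih => exact ih h
  | regc | unit | int | get => rfl

theorem count_le_count {b b' : ℕ → ℕ} (h : ∀ x, b x ≤ b' x) (M : Tm) :
    M.count b ≤ M.count b' := by
  have : b' = fun x => b x + (b' x - b x) := by
    funext x; have := h x; omega
  rw [this, count_add]; omega

/-- The mark of the single variable `k`. -/
def unitMark (k : ℕ) : ℕ → ℕ := fun x => if x = k then 1 else 0

theorem consMark_unitMark (k : ℕ) : consMark 0 (unitMark k) = unitMark (k + 1) := by
  funext x; cases x <;> simp [unitMark]

theorem count_eq_add (b : ℕ → ℕ) (k : ℕ) (M : Tm) :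
    M.count b = M.count (fun x => if x = k then 0 else b x) + b k * M.count (unitMark k) := by
  rw [← count_mul, ← count_add]
  congr 1
  funext x
  by_cases h : x = k <;> simp [unitMark, h]

theorem count_unitMark_eq_zero {k : ℕ} {M : Tm} (h : M.AllOcc (fun _ x => x ≠ k)) :
    M.count (unitMark k) = 0 := by
  rw [← count_zero M]
  exact count_congr (h.mono fun p x hx => by simp [unitMark, hx])

/-- The terms put in by a lifted substitution are shifted and avoid the variable `0`. Together with
`AllOcc.subst_liftSub`, this keeps the conditions at binders stable under substitution. -/
theorem count_unitMark_liftSub (σ : ℕ → Tm) (M : Tm) :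
    (M.subst (liftSub σ)).count (unitMark 0) = M.count (unitMark 0) := by
  rw [count_subst]
  congr 1
  funext x
  cases x with
  | zero => rfl
  | succ x =>
    rw [liftSub, count_rename]
    exact count_zero _

theorem count_unitMark_liftRen (ρ : ℕ → ℕ) (M : Tm) :
    (M.rename (liftRen ρ)).count (unitMark 0) = M.count (unitMark 0) := by
  rw [count_rename]
  congr 1
  funext x
  cases x <;> rfl

theorem AllOcc.subst_liftSub {T : List Modality → Prop} {M : Tm} (σ : ℕ → Tm)
    (h : M.AllOcc (fun p x => x = 0 → T p)) :
    (M.subst (liftSub σ)).AllOcc (fun p x => x = 0 → T p) := by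
  refine AllOcc.subst (h.mono fun p x hx => ?_)
  cases x with
  | zero => simpa [liftSub, AllOcc] using hx
  | succ x => exact AllOcc.rename (allOcc_of_forall (fun q y hy => by simp at hy) _)

theorem AllOcc.rename_liftRen {T : List Modality → Prop} {M : Tm} (ρ : ℕ → ℕ)
    (h : M.AllOcc (fun p x => x = 0 → T p)) :
    (M.rename (liftRen ρ)).AllOcc (fun p x => x = 0 → T p) := by
  refine AllOcc.rename (h.mono fun p x hx => ?_)
  cases x with
  | zero => exact hx
  | succ x => exact fun hy => by simp [liftRen] at hy

end Tm
-- Potential and stratification of terms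
/-- Coefficients of the potential at each level: `node` for the nodes, `box` for the contents of
a box `!V` that still contains a variable to be instantiated. -/
structure Weights : Type where
  node : ℕ → ℕ
  box : ℕ → ℕ

/-- Variables bound by `let !x` are marked. -/
def Modality.mark : Modality → ℕ
  | .bang => 1
  | .para => 0

/-- The possible positions of a variable bound by `let m x`. -/
def Modality.BoundOcc : Modality → List Modality → Prop
  | .bang, p => p.length = 1
  | .para, p => p = [.para]

namespace Tm

open Classical in
/-- `0` for values and `1` for other terms. -/
noncomputable def pending (M : Tm) : ℕ := if M.IsValue then 0 else 1

/-- The potential of a term at level `δ`, where `b` marks the variables bound by `let !x`. -/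
noncomputable def weight (w : Weights) : ℕ → (ℕ → ℕ) → Tm → ℕ
  -- A variable bound by `let !` occurs one level below its binder, so `δ - 1` is the level of the
  -- `let`: this prepays the copy to be placed here.
  | δ, b, var x => b x * w.node (δ - 1)
  | δ, b, lam M => weight w δ (consMark 0 b) M
  | _, _, regc _ => 0
  | _, _, unit => 0
  | _, _, int _ => 0
  -- Three units pay for the three moves of an application: evaluating the argument, swapping, and
  -- the beta step.
  | δ, b, app M N => weight w δ b M + weight w δ b N + 3 * w.node δ
  | δ, b, arith _ V W => weight w δ b V + weight w δ b W + w.node δ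
  -- The two units pay for entering and leaving `§`; nothing is due once the content is a value.
  | δ, b, mod .para M => weight w (δ + 1) b M + M.pending * (2 * w.node δ)
  | δ, b, mod .bang V =>
      -- A box without marked variables is free here; its contents are controlled by `BoxBound`
      -- instead. Marks are reset inside the box, since the factor `box δ` already accounts for the
      -- variable to be filled.
      if count b V = 0 then 0 else w.box δ * weight w (δ + 1) (fun _ => 0) V
  | δ, b, lett m V M => weight w δ b V + weight w δ (consMark m.mark b) M + w.node δ
  | δ, _, get _ => w.node δ
  | δ, b, set _ V => weight w δ b V + w.node δ

/-- Stratification of a term at level `δ`, with levels bounded by `D` and region levels `L`: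
variables bound by `λ`, `let §` are used at most once, at relative levels 0 and 1; variables bound
by `let !` are used at relative level 1; a box `!V` contains at most one occurrence of a marked
variable, and satisfies `Q` if it contains none. -/
def Stratified (L : Region → ℕ) (D : ℕ) (Q : ℕ → Tm → Prop) : ℕ → (ℕ → ℕ) → Tm → Prop
  | _, _, var _ => True
  | δ, b, lam M => AllOcc (fun p x => x = 0 → p = []) M ∧ count (unitMark 0) M ≤ 1 ∧
      Stratified L D Q δ (consMark 0 b) M
  | δ, _, regc r => L r = δ
  | _, _, unit => True
  | _, _, int _ => True
  | δ, b, app M N => Stratified L D Q δ b M ∧ Stratified L D Q δ b N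
  | δ, b, arith _ V W => Stratified L D Q δ b V ∧ Stratified L D Q δ b W
  | δ, b, mod .para M => δ < D ∧ Stratified L D Q (δ + 1) b M
  | δ, b, mod .bang V => δ < D ∧ V.IsValue ∧ count b V ≤ 1 ∧ (count b V = 0 → Q δ V) ∧
      Stratified L D Q (δ + 1) (fun _ => 0) V
  | δ, b, lett m V M => AllOcc (fun p x => x = 0 → m.BoundOcc p) M ∧
      (m = .para → count (unitMark 0) M ≤ 1) ∧ Stratified L D Q δ b V ∧
      Stratified L D Q δ (consMark m.mark b) M
  | δ, _, get r => L r = δ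
  | δ, b, set r V => L r = δ ∧ Stratified L D Q δ b V

theorem pending_of_isValue {M : Tm} (h : M.IsValue) : M.pending = 0 := if_pos h

theorem pending_of_not_isValue {M : Tm} (h : ¬ M.IsValue) : M.pending = 1 := if_neg h

theorem pending_congr {M N : Tm} (h : M.IsValue ↔ N.IsValue) : M.pending = N.pending := by
  rw [pending, pending, propext h]

theorem weight_rename (w : Weights) (δ : ℕ) (b : ℕ → ℕ) (ρ : ℕ → ℕ) (M : Tm) :
    (M.rename ρ).weight w δ b = M.weight w δ (fun x => b (ρ x)) := by
  induction M generalizing δ b ρ with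
  | mod m M ih =>
    cases m with
    | bang => simp [rename, weight, ih, count_rename]
    | para => simp only [rename, weight, ih, pending_congr (isValue_rename ρ M)]
  | _ => simp_all [rename, weight, consMark_comp_liftRen]

theorem Stratified.mono {L : Region → ℕ} {D : ℕ} {Q Q' : ℕ → Tm → Prop} {δ : ℕ} {b : ℕ → ℕ}
    {M : Tm} (h : M.Stratified L D Q δ b) (hQ : ∀ δ V, Q δ V → Q' δ V) :
    M.Stratified L D Q' δ b := by
  induction M generalizing δ b with
  | var x => trivial
  | lam M ih => exact ⟨h.1, h.2.1, ih h.2.2⟩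
  | app M N ih₁ ih₂ => exact ⟨ih₁ h.1, ih₂ h.2⟩
  | arith _ M N ih₁ ih₂ => exact ⟨ih₁ h.1, ih₂ h.2⟩
  | mod m M ih =>
    cases m with
    | bang => exact ⟨h.1, h.2.1, h.2.2.1, fun h0 => hQ _ _ (h.2.2.2.1 h0), ih h.2.2.2.2⟩
    | para => exact ⟨h.1, ih h.2⟩
  | lett m V M ih₁ ih₂ => exact ⟨h.1, h.2.1, ih₁ h.2.2.1, ih₂ h.2.2.2⟩
  | set r V ih => exact ⟨h.1, ih h.2⟩
  | regc | get => exact h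
  | unit | int => trivial

theorem Stratified.rename {L : Region → ℕ} {D : ℕ} {Q : ℕ → Tm → Prop} {δ : ℕ} {b : ℕ → ℕ}
    {M : Tm} {ρ : ℕ → ℕ} (hQ : ∀ δ V (ρ : ℕ → ℕ), Q δ V → Q δ (V.rename ρ))
    (h : M.Stratified L D Q δ (fun x => b (ρ x))) : (M.rename ρ).Stratified L D Q δ b := by
  induction M generalizing δ b ρ with
  | var x => trivial
  | lam M ih =>
    refine ⟨h.1.rename_liftRen ρ, (count_unitMark_liftRen ρ M).trans_le h.2.1, ih ?_⟩
    rw [consMark_comp_liftRen]; exact h.2.2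
  | app M N ih₁ ih₂ => exact ⟨ih₁ h.1, ih₂ h.2⟩
  | arith _ M N ih₁ ih₂ => exact ⟨ih₁ h.1, ih₂ h.2⟩
  | mod m M ih =>
    cases m with
    | bang =>
      refine ⟨h.1, (isValue_rename ρ M).2 h.2.1, (count_rename b ρ M).trans_le h.2.2.1,
        fun h0 => hQ _ _ _ (h.2.2.2.1 ?_), ih h.2.2.2.2⟩
      rwa [count_rename] at h0
    | para => exact ⟨h.1, ih h.2⟩
  | lett m V M ih₁ ih₂ =>
    refine ⟨h.1.rename_liftRen ρ, fun hm => (count_unitMark_liftRen ρ M).trans_le (h.2.1 hm),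
      ih₁ h.2.2.1, ih₂ ?_⟩
    rw [consMark_comp_liftRen]; exact h.2.2.2
  | set r V ih => exact ⟨h.1, ih h.2⟩
  | regc | get => exact h
  | unit | int => trivial

/-! ### Effect of substitution on potential and stratification -/

/-- `σ` replaces the variable `k` by a copy of `V` whose variables are unmarked, and every other
variable by a variable with the same mark. -/
structure Replaces (b b' : ℕ → ℕ) (σ : ℕ → Tm) (k : ℕ) (V : Tm) : Prop where
  other : ∀ x, x ≠ k → ∃ y, σ x = var y ∧ b' y = b x
  self : ∃ ρ : ℕ → ℕ, σ k = V.rename ρ ∧ ∀ x, b' (ρ x) = 0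

theorem replaces_single (n : ℕ) (V : Tm) :
    Replaces (consMark n fun _ => 0) (fun _ => 0) (single V) 0 V where
  other x hx := by
    cases x with
    | zero => exact absurd rfl hx
    | succ x => exact ⟨x, rfl, rfl⟩
  self := ⟨fun x => x, (rename_id V).symm, fun _ => rfl⟩

namespace Replaces

variable {b b' : ℕ → ℕ} {σ : ℕ → Tm} {k : ℕ} {V : Tm}

theorem lift (h : Replaces b b' σ k V) (n : ℕ) :
    Replaces (consMark n b) (consMark n b') (liftSub σ) (k + 1) V where
  other x hx := by
    cases x with
    | zero => exact ⟨0, rfl, rfl⟩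
    | succ x =>
      obtain ⟨y, hy, hb⟩ := h.other x (by omega)
      exact ⟨y + 1, by simp [liftSub, hy, Tm.rename], hb⟩
  self := by
    obtain ⟨ρ, hρ, hb⟩ := h.self
    exact ⟨fun x => (ρ x).succ, by simp [liftSub, hρ, rename_rename], hb⟩

theorem unmarked (h : Replaces b b' σ k V) : Replaces (fun _ => 0) (fun _ => 0) σ k V where
  other x hx := by
    obtain ⟨y, hy, -⟩ := h.other x hx
    exact ⟨y, hy, rfl⟩
  self := by
    obtain ⟨ρ, hρ, -⟩ := h.self
    exact ⟨ρ, hρ, fun _ => rfl⟩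

theorem isValue (h : Replaces b b' σ k V) (hV : V.IsValue) (x : ℕ) : (σ x).IsValue := by
  by_cases hx : x = k
  · obtain ⟨ρ, hρ, -⟩ := h.self
    rw [hx, hρ]; exact (isValue_rename ρ V).2 hV
  · obtain ⟨y, hy, -⟩ := h.other x hx
    rw [hy]; exact .var y

theorem count (h : Replaces b b' σ k V) (M : Tm) :
    (M.subst σ).count b' + b k * M.count (unitMark k) = M.count b := by
  rw [count_subst, count_eq_add b k M]
  congr 2
  funext x
  by_cases hx : x = k
  · obtain ⟨ρ, hρ, hb⟩ := h.self
    rw [hx, if_pos rfl, hρ, count_rename, ← count_zero V]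
    simp [hb]
  · obtain ⟨y, hy, hb⟩ := h.other x hx
    rw [if_neg hx, hy, ← hb]; rfl

end Replaces

theorem allOcc_liftOcc {T : List Modality → Prop} {k : ℕ} {M : Tm}
    (h : M.AllOcc (liftOcc fun p x => x = k → T p)) : M.AllOcc (fun p x => x = k + 1 → T p) := by
  refine h.mono fun p x hx => ?_
  cases x with
  | zero => simp
  | succ x => simpa [liftOcc] using hx

theorem allOcc_ne_of_box {k l δ : ℕ} {M : Tm} (hM : (mod .bang M).AllOcc
    (fun p x => x = k → (∀ m ∈ p, m = .para) ∧ δ + p.length = l)) :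
    M.AllOcc (fun _ x => x ≠ k) :=
  AllOcc.mono (M := M) hM fun p x hx e => by simpa using (hx e).1

theorem allOcc_of_para {k l δ : ℕ} {M : Tm} (hM : (mod .para M).AllOcc
    (fun p x => x = k → (∀ m ∈ p, m = .para) ∧ δ + p.length = l)) :
    M.AllOcc (fun p x => x = k → (∀ m ∈ p, m = .para) ∧ δ + 1 + p.length = l) :=
  AllOcc.mono (M := M) hM fun p x hx e => by
    have := hx e
    simp only [List.mem_cons, forall_eq_or_imp, List.length_cons] at this
    exact ⟨this.1.2, by omega⟩

/-- The substitution of a variable that does not occur in boxes `!V`. -/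
theorem weight_subst (w : Weights) {b b' : ℕ → ℕ} {σ : ℕ → Tm} {k l δ : ℕ} {V M : Tm}
    (hV : V.IsValue) (hσ : Replaces b b' σ k V)
    (hM : M.AllOcc (fun p x => x = k → (∀ m ∈ p, m = .para) ∧ δ + p.length = l)) :
    (M.subst σ).weight w δ b' + M.count (unitMark k) * (b k * w.node (l - 1)) =
      M.weight w δ b + M.count (unitMark k) * V.weight w l (fun _ => 0) := by
  induction M generalizing δ b b' σ k with
  | var x =>
    by_cases hx : x = k
    · subst hx
      obtain ⟨ρ, hρ, hb⟩ := hσ.self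
      obtain rfl : δ = l := by simpa using (hM rfl).2
      simp [subst, hρ, weight_rename, hb, weight, Tm.count, unitMark, add_comm]
    · obtain ⟨y, hy, hb⟩ := hσ.other x hx
      simp [subst, hy, weight, Tm.count, unitMark, hx, hb]
  | lam M ih =>
    have := ih (hσ.lift 0) (allOcc_liftOcc hM)
    simpa [subst, weight, Tm.count, consMark_unitMark] using this
  | app M N ih₁ ih₂ =>
    have h₁ := ih₁ hσ hM.1
    have h₂ := ih₂ hσ hM.2
    simp only [subst, weight, Tm.count, add_mul]
    omega
  | arith _ M N ih₁ ih₂ =>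
    have h₁ := ih₁ hσ hM.1
    have h₂ := ih₂ hσ hM.2
    simp only [subst, weight, Tm.count, add_mul]
    omega
  | mod m M ih =>
    cases m with
    | bang =>
      -- The variable cannot occur below `!`, so the potential of the contents and the test for
      -- marked variables are both unchanged.
      have hk := allOcc_ne_of_box hM
      have := ih (δ := δ + 1) hσ.unmarked (hk.mono fun p x hx e => absurd e hx)
      replace hk := count_unitMark_eq_zero hk
      have hc := hσ.count M
      simp only [hk, mul_zero, zero_mul, add_zero] at hc this
      simp [subst, weight, Tm.count, hc, this, hk]
    | para =>
      have := ih (δ := δ + 1) hσ (allOcc_of_para hM)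
      simp only [subst, weight, Tm.count, pending_congr (isValue_subst (hσ.isValue hV) M)]
      omega
  | lett m W M ih₁ ih₂ =>
    have h₁ := ih₁ hσ hM.1
    have h₂ := ih₂ (hσ.lift m.mark) (allOcc_liftOcc hM.2)
    simp only [consMark_succ] at h₂
    simp only [subst, weight, Tm.count, add_mul, consMark_unitMark]
    omega
  | set r W ih =>
    have h := ih hσ hM
    simp only [subst, weight, Tm.count]
    omega
  | regc | unit | int | get => simp [subst, weight, Tm.count]

/-- The potential of the contents `V` of a box, together with an amount `c` that may still be
added to it, is bounded. -/
def BoxBound (w : Weights) (Z c δ : ℕ) (V : Tm) : Prop :=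
  w.box δ * V.weight w (δ + 1) (fun _ => 0) + c ≤ Z

theorem BoxBound.rename {w : Weights} {Z c : ℕ} (δ : ℕ) (V : Tm) (ρ : ℕ → ℕ)
    (h : BoxBound w Z c δ V) : BoxBound w Z c δ (V.rename ρ) := by
  rwa [BoxBound, weight_rename]

/-- The parameter `c` will be the potential of the whole configuration; as it falls along a run, the
invariant for the old value implies that for the new one. -/
theorem Stratified.mono_bound {w : Weights} {Z c c' : ℕ} {L : Region → ℕ} {D δ : ℕ} {b : ℕ → ℕ}
    {M : Tm} (h : M.Stratified L D (BoxBound w Z c) δ b) (hc : c' ≤ c) :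
    M.Stratified L D (BoxBound w Z c') δ b :=
  h.mono fun _ _ hV => le_trans (Nat.add_le_add_left hc _) hV

theorem Replaces.stratified_self {w : Weights} {Z c : ℕ} {L : Region → ℕ} {D : ℕ} {b b' : ℕ → ℕ}
    {σ : ℕ → Tm} {k l : ℕ} {V : Tm} (hσ : Replaces b b' σ k V)
    (hVs : V.Stratified L D (BoxBound w Z c) l fun _ => 0) :
    (σ k).Stratified L D (BoxBound w Z c) l b' := by
  obtain ⟨ρ, hρ, hb⟩ := hσ.self
  rw [hρ]
  refine Stratified.rename BoxBound.rename ?_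
  simpa [hb] using hVs

/-- The substitution of a variable that does not occur in boxes `!V`. -/
theorem Stratified.subst {w : Weights} {Z c : ℕ} {L : Region → ℕ} {D : ℕ} {b b' : ℕ → ℕ}
    {σ : ℕ → Tm} {k l δ : ℕ} {V M : Tm} (hV : V.IsValue) (hσ : Replaces b b' σ k V)
    (hVs : V.Stratified L D (BoxBound w Z c) l fun _ => 0)
    (hM : M.AllOcc (fun p x => x = k → (∀ m ∈ p, m = .para) ∧ δ + p.length = l))
    (h : M.Stratified L D (BoxBound w Z c) δ b) :
    (M.subst σ).Stratified L D (BoxBound w Z c) δ b' := by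
  induction M generalizing δ b b' σ k with
  | var x =>
    by_cases hx : x = k
    · subst hx
      obtain rfl : δ = l := by simpa using (hM rfl).2
      exact hσ.stratified_self hVs
    · obtain ⟨y, hy, -⟩ := hσ.other x hx
      simp [Tm.subst, hy, Stratified]
  | lam M ih =>
    exact ⟨h.1.subst_liftSub σ, (count_unitMark_liftSub σ M).trans_le h.2.1,
      ih (hσ.lift 0) (allOcc_liftOcc hM) h.2.2⟩
  | app M N ih₁ ih₂ => exact ⟨ih₁ hσ hM.1 h.1, ih₂ hσ hM.2 h.2⟩
  | arith _ M N ih₁ ih₂ => exact ⟨ih₁ hσ hM.1 h.1, ih₂ hσ hM.2 h.2⟩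
  | mod m M ih =>
    cases m with
    | bang =>
      have hk := allOcc_ne_of_box hM
      have hM' : M.AllOcc (fun p x => x = k → (∀ m ∈ p, m = .para) ∧ δ + 1 + p.length = l) :=
        hk.mono fun p x hx e => absurd e hx
      have hw := weight_subst w hV hσ.unmarked hM'
      replace hk := count_unitMark_eq_zero hk
      have hc := hσ.count M
      simp only [hk, mul_zero, zero_mul, add_zero] at hc hw
      refine ⟨h.1, (isValue_subst (hσ.isValue hV) M).2 h.2.1, hc.trans_le h.2.2.1,
        fun h0 => ?_, ih hσ.unmarked hM' h.2.2.2.2⟩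
      rw [BoxBound, hw]
      exact h.2.2.2.1 (hc ▸ h0)
    | para => exact ⟨h.1, ih hσ (allOcc_of_para hM) h.2⟩
  | lett m W M ih₁ ih₂ =>
    exact ⟨h.1.subst_liftSub σ, fun hm => (count_unitMark_liftSub σ M).trans_le (h.2.1 hm),
      ih₁ hσ hM.1 h.2.2.1, ih₂ (hσ.lift m.mark) (allOcc_liftOcc hM.2) h.2.2.2⟩
  | set r W ih => exact ⟨h.1, ih hσ hM h.2⟩
  | regc | get => exact h
  | unit | int => trivial

/-- The substitution of the contents of a box for a variable bound by `let !`: the potential does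
not increase, and the potentials of boxes increase at most by as much as it decreases. -/
theorem Stratified.subst_box {w : Weights} {Z c : ℕ} {L : Region → ℕ} {D : ℕ} {b b' : ℕ → ℕ}
    {σ : ℕ → Tm} {k δ : ℕ} {V M : Tm} (hV : V.IsValue) (hσ : Replaces b b' σ k V) (hk : b k = 1)
    (hVs : V.Stratified L D (BoxBound w Z c) (δ + 1) fun _ => 0) (hVb : BoxBound w Z c δ V)
    (hVw : V.weight w (δ + 1) (fun _ => 0) ≤ w.node δ)
    (hM : M.AllOcc (fun p x => x = k → p.length = 1))
    (h : M.Stratified L D (BoxBound w Z c) δ b) :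
    (M.subst σ).weight w δ b' ≤ M.weight w δ b ∧
      ∀ c', c' + M.weight w δ b ≤ c + (M.subst σ).weight w δ b' →
        (M.subst σ).Stratified L D (BoxBound w Z c') δ b' := by
  induction M generalizing b b' σ k with
  | var x =>
    -- The path to a bare variable is empty, whereas `k` occurs only below exactly one modality.
    have hx : x ≠ k := fun e => by simpa using hM e
    obtain ⟨y, hy, hb⟩ := hσ.other x hx
    simp [Tm.subst, hy, Stratified, weight, hb]
  | lam M ih =>
    have := ih (hσ.lift 0) hk (allOcc_liftOcc hM) h.2.2
    exact ⟨this.1, fun c' hc => ⟨h.1.subst_liftSub σ,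
      (count_unitMark_liftSub σ M).trans_le h.2.1, this.2 c' hc⟩⟩
  | app M N ih₁ ih₂ =>
    have h₁ := ih₁ hσ hk hM.1 h.1
    have h₂ := ih₂ hσ hk hM.2 h.2
    simp only [Tm.subst, weight]
    exact ⟨by omega, fun c' hc => ⟨h₁.2 c' (by omega), h₂.2 c' (by omega)⟩⟩
  | arith _ M N ih₁ ih₂ =>
    have h₁ := ih₁ hσ hk hM.1 h.1
    have h₂ := ih₂ hσ hk hM.2 h.2
    simp only [Tm.subst, weight]
    exact ⟨by omega, fun c' hc => ⟨h₁.2 c' (by omega), h₂.2 c' (by omega)⟩⟩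
  | mod m M ih =>
    -- Below the first modality no further one separates `k` from the root of `M`, so the exact
    -- formula `weight_subst` applies at level `δ + 1`.
    have hM' : M.AllOcc (fun p x => x = k → (∀ m ∈ p, m = .para) ∧ δ + 1 + p.length = δ + 1) :=
      AllOcc.mono (M := M) hM fun p x hx e => by
        have : p = [] := by simpa using hx e
        simp [this]
    cases m with
    | bang =>
      obtain ⟨hD, hMv, hc1, hQ, hs⟩ := h
      have hw := weight_subst w hV hσ.unmarked hM'
      have hc := hσ.count M
      have hs' := Stratified.subst hV hσ.unmarked hVs hM' hs
      rw [hk, one_mul] at hc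
      simp only [zero_mul, mul_zero, add_zero] at hw
      simp only [Tm.subst, weight, Stratified]
      rcases Nat.eq_zero_or_pos (M.count (unitMark k)) with h0 | h0
      · rw [h0, zero_mul, add_zero] at hw
        rw [h0, add_zero] at hc
        rw [hc, hw]
        refine ⟨le_rfl, fun c' hcc => ⟨hD, (isValue_subst (hσ.isValue hV) M).2 hMv, hc1,
          fun e => ?_, hs'.mono_bound (by omega)⟩⟩
        rw [BoxBound, hw]
        have := hQ e
        rw [BoxBound] at this
        omega
      -- The only marked occurrence of the box is filled. The box drops out of the potential,
      -- releasing `box δ` times the weight of `M`, exactly the room that `M` needs beside `V` in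
      -- `BoxBound`.
      · have h1 : M.count (unitMark k) = 1 := by omega
        rw [h1, one_mul] at hw
        rw [if_pos (by omega), if_neg (by omega)]
        refine ⟨Nat.zero_le _, fun c' hcc => ⟨hD, (isValue_subst (hσ.isValue hV) M).2 hMv,
          by omega, fun _ => ?_, hs'.mono_bound (by omega)⟩⟩
        rw [BoxBound] at hVb ⊢
        rw [hw, mul_add]
        omega
    | para =>
      have hw := weight_subst w hV hσ hM'
      rw [hk, one_mul, Nat.add_sub_cancel] at hw
      -- Under `§`, each copy of `V` is paid for by the prepaid `node δ` of the occurrence it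
      -- replaces.
      have := Nat.mul_le_mul_left (M.count (unitMark k)) hVw
      simp only [Tm.subst, weight, pending_congr (isValue_subst (hσ.isValue hV) M)]
      exact ⟨by omega, fun c' hc => ⟨h.1,
        (Stratified.subst hV hσ hVs hM' h.2).mono_bound (by omega)⟩⟩
  | lett m W M ih₁ ih₂ =>
    have h₁ := ih₁ hσ hk hM.1 h.2.2.1
    have h₂ := ih₂ (hσ.lift m.mark) hk (allOcc_liftOcc hM.2) h.2.2.2
    simp only [Tm.subst, weight]
    exact ⟨by omega, fun c' hc => ⟨h.1.subst_liftSub σ,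
      fun hm => (count_unitMark_liftSub σ M).trans_le (h.2.1 hm),
      h₁.2 c' (by omega), h₂.2 c' (by omega)⟩⟩
  | set r W ih =>
    have h₁ := ih hσ hk hM h.2
    simp only [Tm.subst, weight]
    exact ⟨by omega, fun c' hc => ⟨h.1, h₁.2 c' (by omega)⟩⟩
  | regc | get => exact ⟨le_rfl, fun _ _ => h⟩
  | unit | int => exact ⟨le_rfl, fun _ _ => trivial⟩

end Tm
-- Typing implies stratification
/-- The number of modalities below which a region may be accessed, in a term typed with the depth
index `δ₀`. -/
def RegCtx.level (R : RegCtx) (δ₀ : ℕ) (r : Region) : ℕ := δ₀ - ((R r).map Prod.fst).getD 0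

/-- The positions at which a variable of the given usage may occur. -/
def Usage.Pos : Usage → List Modality → Prop
  | .lam, p => p = []
  | .mod m, p => m.BoundOcc p

/-- Every free variable occurrence is declared in `Γ`, at a position allowed by its usage. -/
def Ctx.Covers (Γ : Ctx) (M : Tm) : Prop :=
  M.AllOcc fun p x => ∃ (u : Usage) (A : Ty), Γ x = some (u, A) ∧ u.Pos p

/-- Variables of usage `λ` or `§` occur at most once. -/
def Ctx.Linear (Γ : Ctx) (M : Tm) : Prop :=
  ∀ (x : ℕ) (u : Usage) (A : Ty), Γ x = some (u, A) → u ≠ .mod .bang → M.count (Tm.unitMark x) ≤ 1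

namespace Ctx

theorem Covers.count_eq_zero {Γ : Ctx} {M : Tm} (h : Γ.Covers M) {x : ℕ} (hx : Γ x = none) :
    M.count (Tm.unitMark x) = 0 :=
  Tm.count_unitMark_eq_zero (Tm.AllOcc.mono h fun _ y ⟨u, A, hy, _⟩ e => by simp [e, hx] at hy)

theorem Covers.mono {Γ Δ : Ctx} {M : Tm} (h : Γ.Covers M)
    (hΓ : ∀ x u A, Γ x = some (u, A) → Δ x = some (u, A)) : Δ.Covers M :=
  Tm.AllOcc.mono h fun _ x ⟨u, A, hx, hp⟩ => ⟨u, A, hΓ x u A hx, hp⟩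

theorem Covers.of_cons {Γ : Ctx} {M : Tm} {u : Usage} {A : Ty} (h : (Γ.cons u A).Covers M) :
    M.AllOcc (Tm.liftOcc fun p x => ∃ (u : Usage) (A : Ty), Γ x = some (u, A) ∧ u.Pos p) :=
  Tm.AllOcc.mono h fun p x hx => by
    cases x with
    | zero => trivial
    | succ x => exact hx

theorem Covers.pos_zero {Γ : Ctx} {M : Tm} {u : Usage} {A : Ty} (h : (Γ.cons u A).Covers M) :
    M.AllOcc fun p x => x = 0 → u.Pos p :=
  Tm.AllOcc.mono h fun p x ⟨u', A', hx, hp⟩ e => by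
    subst e
    simp only [cons, Option.some.injEq, Prod.mk.injEq] at hx
    exact hx.1 ▸ hp

theorem union_left {Γ Δ : Ctx} {x : ℕ} {a : Usage × Ty} (h : Γ x = some a) :
    Γ.union Δ x = some a := by
  simp [union, h]

theorem Disjoint.union_right {Γ Δ : Ctx} (hd : Γ.Disjoint Δ) {x : ℕ} {a : Usage × Ty}
    (h : Δ x = some a) : Γ.union Δ x = some a := by
  rcases hd x with h' | h'
  · simp [union, h, h']
  · simp [h] at h'

/-- The counting functions are abstract because the body of a `let` counts its variables under a
shifted index. -/
theorem Disjoint.count_union {Γ Δ : Ctx} (hd : Γ.Disjoint Δ) {n₁ n₂ : ℕ → ℕ}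
    (h₁ : ∀ x, Γ x = none → n₁ x = 0) (h₂ : ∀ x, Δ x = none → n₂ x = 0)
    (l₁ : ∀ (x : ℕ) (u : Usage) (A : Ty), Γ x = some (u, A) → u ≠ .mod .bang → n₁ x ≤ 1)
    (l₂ : ∀ (x : ℕ) (u : Usage) (A : Ty), Δ x = some (u, A) → u ≠ .mod .bang → n₂ x ≤ 1)
    (x : ℕ) (u : Usage) (A : Ty) (hx : Γ.union Δ x = some (u, A)) (hu : u ≠ .mod .bang) :
    n₁ x + n₂ x ≤ 1 := by
  rcases hd x with h | h
  · rw [union, h, Option.none_or] at hx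
    rw [h₁ x h, zero_add]
    exact l₂ x u A hx hu
  · rw [union, h, Option.or_none] at hx
    rw [h₂ x h, add_zero]
    exact l₁ x u A hx hu

end Ctx

/-- Crossing a modality raises the level `i` and lowers the depth index `δ` by one, so `i + δ` is
constant and each region has a single access level. Marks are arbitrary in the induction because
binders and contractions change them; `Covers` and `Linear` supply the conditions at binders. -/
theorem HasType.stratified {R : RegCtx} {Γ : Ctx} {δ : ℕ} {M : Tm} {A : Ty}
    (h : HasType R Γ δ M A) :
    (∀ (i D : ℕ) (b : ℕ → ℕ), i + M.depth ≤ D → (∀ x, b x ≤ 1) →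
      M.Stratified (R.level (i + δ)) D (fun _ _ => True) i b) ∧ Γ.Covers M ∧ Γ.Linear M := by
  have hcons : ∀ (n : ℕ) (b : ℕ → ℕ), n ≤ 1 → (∀ x, b x ≤ 1) → ∀ x, consMark n b x ≤ 1 := by
    intro n b hn hb x
    cases x with
    | zero => exact hn
    | succ x => exact hb x
  induction h with
  | int | unit =>
    exact ⟨fun _ _ _ _ _ => trivial, trivial, fun _ _ _ _ _ => Nat.zero_le _⟩
  | regc hR hr =>
    refine ⟨fun i _ _ _ _ => ?_, trivial, fun _ _ _ _ _ => Nat.zero_le _⟩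
    simp [Tm.Stratified, RegCtx.level, hr]
  | var δ x A hR =>
    refine ⟨fun _ _ _ _ _ => trivial, ⟨.lam, A, by simp [Ctx.insert], rfl⟩, fun y _ _ _ _ => ?_⟩
    simp only [Tm.count, Tm.unitMark]
    split <;> omega
  | arith op hd _ _ _ _ ih₁ ih₂ =>
    refine ⟨fun i D b hD hb => ⟨ih₁.1 i D b ?_ hb, ih₂.1 i D b ?_ hb⟩,
      ⟨ih₁.2.1.mono fun x u A => Ctx.union_left, ih₂.2.1.mono fun x u A => hd.union_right⟩,
      hd.count_union (fun x => ih₁.2.1.count_eq_zero) (fun x => ih₂.2.1.count_eq_zero)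
        ih₁.2.2 ih₂.2.2⟩ <;> simp only [Tm.depth] at hD <;> omega
  | app hd _ _ ih₁ ih₂ =>
    refine ⟨fun i D b hD hb => ⟨ih₁.1 i D b ?_ hb, ih₂.1 i D b ?_ hb⟩,
      ⟨ih₁.2.1.mono fun x u A => Ctx.union_left, ih₂.2.1.mono fun x u A => hd.union_right⟩,
      hd.count_union (fun x => ih₁.2.1.count_eq_zero) (fun x => ih₂.2.1.count_eq_zero)
        ih₁.2.2 ih₂.2.2⟩ <;> simp only [Tm.depth] at hD <;> omega
  | @contr Γ δ M A B x y z hx hy hz hxy _ ih =>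
    refine ⟨fun i D b hD hb => Tm.Stratified.rename (fun _ _ _ _ => trivial)
      (ih.1 i D _ (by rwa [Tm.depth_rename] at hD) fun x => hb _), Tm.AllOcc.rename ?_, ?_⟩
    · refine Tm.AllOcc.mono ih.2.1 fun p i ⟨u, A', hi, hp⟩ => ?_
      by_cases h : i = x ∨ i = y
      -- The merged variables have usage `!`, which allows the same positions for the new variable
      -- and imposes no linearity.
      · have hu : u = .mod .bang := by
          rcases h with rfl | rfl
          · simp only [Ctx.insert, Function.update_of_ne hxy, Function.update_self,
              Option.some.injEq, Prod.mk.injEq] at hi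
            exact hi.1.symm
          · simp only [Ctx.insert, Function.update_self, Option.some.injEq,
              Prod.mk.injEq] at hi
            exact hi.1.symm
        exact ⟨.mod .bang, A, by simp [contractRen, h, Ctx.insert], hu ▸ hp⟩
      · have h' := not_or.1 h
        rw [Ctx.insert, Ctx.insert, Function.update_of_ne h'.2, Function.update_of_ne h'.1] at hi
        refine ⟨u, A', ?_, hp⟩
        have hiz : i ≠ z := fun e => by simp [e, hz] at hi
        rw [contractRen, if_neg h, Ctx.insert, Function.update_of_ne hiz, hi]
    · intro v u A' hv hu
      have hvz : v ≠ z := fun e => by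
        subst e
        simp only [Ctx.insert, Function.update_self, Option.some.injEq, Prod.mk.injEq] at hv
        exact hu hv.1.symm
      rw [Ctx.insert, Function.update_of_ne hvz] at hv
      have hvx : v ≠ x := fun e => by simp [e, hx] at hv
      have hvy : v ≠ y := fun e => by simp [e, hy] at hv
      rw [Tm.count_rename]
      have : (fun i => Tm.unitMark v (contractRen x y z i)) = Tm.unitMark v := by
        funext i
        by_cases h : i = x ∨ i = y
        · simp only [Tm.unitMark, contractRen, if_pos h, if_neg hvz.symm]
          rcases h with rfl | rfl
          · rw [if_neg hvx.symm]
          · rw [if_neg hvy.symm]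
        · simp only [contractRen, if_neg h]
      rw [this]
      refine ih.2.2 v u A' ?_ hu
      rw [Ctx.insert, Ctx.insert, Function.update_of_ne hvy, Function.update_of_ne hvx, hv]
  | @weak Γ δ M A B x u hx _ _ ih =>
    refine ⟨ih.1, ih.2.1.mono fun y u' A' hy => ?_, fun y u' A' hy hu => ?_⟩
    · have : y ≠ x := fun e => by simp [e, hx] at hy
      rw [Ctx.insert, Function.update_of_ne this, hy]
    · by_cases h : y = x
      · rw [h, ih.2.1.count_eq_zero hx]; exact Nat.zero_le _
      · rw [Ctx.insert, Function.update_of_ne h] at hy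
        exact ih.2.2 y u' A' hy hu
  | lam _ ih =>
    refine ⟨fun i D b hD hb => ⟨ih.2.1.pos_zero, ih.2.2 0 _ _ rfl nofun,
      ih.1 i D _ hD (hcons 0 b zero_le_one hb)⟩, ih.2.1.of_cons, fun x u A hx hu => ?_⟩
    rw [Tm.count, Tm.consMark_unitMark]
    exact ih.2.2 (x + 1) u A hx hu
  | @bangProm x δ V A B hV _ ih =>
    have hx : V.count (Tm.unitMark x) ≤ 1 := ih.2.2 x .lam A (by simp [Ctx.insert]) nofun
    have hocc : V.AllOcc fun p y => y = x ∧ p = [] :=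
      Tm.AllOcc.mono ih.2.1 fun p y ⟨u, A', hy, hp⟩ => by
        by_cases e : y = x
        · subst e
          simp only [Ctx.insert, Function.update_self, Option.some.injEq, Prod.mk.injEq] at hy
          rw [← hy.1] at hp
          exact ⟨rfl, hp⟩
        · simp [Ctx.insert, Function.update_of_ne e, Ctx.empty] at hy
    refine ⟨fun i D b hD hb => ?_, ?_, ?_⟩
    · simp only [Tm.depth] at hD
      refine ⟨by omega, hV, ?_, fun _ => trivial,
        add_right_comm i 1 δ ▸ ih.1 (i + 1) D _ (by omega) fun _ => Nat.zero_le _⟩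
      -- Only `x` occurs free in `V`, and at most once, so any marks bounded by `1` add up to at
      -- most `1`.
      have : V.count (fun _ => 1) = V.count (Tm.unitMark x) :=
        Tm.count_congr (hocc.mono fun p y hy => by simp [Tm.unitMark, hy.1])
      exact (Tm.count_le_count hb V).trans (this.trans_le hx)
    · exact Tm.AllOcc.mono (M := V) hocc fun p y ⟨hy, hp⟩ =>
        ⟨.mod .bang, A, by simp [Ctx.insert, hy], by simp [hp, Usage.Pos, Modality.BoundOcc]⟩
    · intro y u A' hy hu
      by_cases e : y = x
      · subst e
        exact hx
      · simp [Ctx.insert, Function.update_of_ne e, Ctx.empty] at hy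
  | @bangPromClosed δ V B hV _ ih =>
    have hz : ∀ b, V.count b = 0 := fun b => by
      rw [← Tm.count_zero V]
      exact Tm.count_congr (Tm.AllOcc.mono ih.2.1 fun p y ⟨u, A', hy, _⟩ => by
        simp [Ctx.empty] at hy)
    refine ⟨fun i D b hD hb => ?_, ?_, fun y u A' hy => by simp [Ctx.empty] at hy⟩
    · simp only [Tm.depth] at hD
      exact ⟨by omega, hV, by simp [hz], fun _ => trivial,
        add_right_comm i 1 δ ▸ ih.1 (i + 1) D _ (by omega) fun _ => Nat.zero_le _⟩
    · exact Tm.AllOcc.mono (M := V) ih.2.1 fun p y ⟨u, A', hy, _⟩ => by simp [Ctx.empty] at hy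
  | @paraProm Γ Γ' δ M A hp _ ih =>
    refine ⟨fun i D b hD hb => ?_, ?_, fun x u A' hx hu => ?_⟩
    · simp only [Tm.depth] at hD
      exact ⟨by omega, add_right_comm i 1 δ ▸ ih.1 (i + 1) D b (by omega) hb⟩
    · refine Tm.AllOcc.mono (M := M) ih.2.1 fun p x ⟨u, A', hx, hpos⟩ => ?_
      rcases hp x with ⟨h, -⟩ | ⟨B, m, h, h'⟩
      · simp [h] at hx
      · simp only [h, Option.some.injEq, Prod.mk.injEq] at hx
        rw [← hx.1] at hpos
        refine ⟨.mod m, B, h', ?_⟩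
        cases m <;> simp_all [Usage.Pos, Modality.BoundOcc]
    · rcases hp x with ⟨-, h⟩ | ⟨B, m, h, -⟩
      · simp [h] at hx
      · exact ih.2.2 x .lam B h nofun
  | @lett Γ Δ δ V M A B m hd _ _ _ ih₁ ih₂ =>
    refine ⟨fun i D b hD hb => ?_,
      ⟨ih₁.2.1.mono fun x u A => Ctx.union_left, ?_⟩,
      hd.count_union (n₂ := fun x => M.count (consMark 0 (Tm.unitMark x)))
        (fun x => ih₁.2.1.count_eq_zero) (fun x hx => ?_) ih₁.2.2 fun x u A hx hu => ?_⟩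
    · simp only [Tm.depth] at hD
      refine ⟨ih₂.2.1.pos_zero, fun hm => ?_, ih₁.1 i D b (by omega) hb,
        ih₂.1 i D _ (by omega) (hcons _ b (by cases m <;> simp [Modality.mark]) hb)⟩
      subst hm
      exact ih₂.2.2 0 _ _ rfl (by simp)
    · refine ih₂.2.1.of_cons.mono fun p x hx => ?_
      cases x with
      | zero => trivial
      | succ x =>
        obtain ⟨u, A, hx, hp⟩ := hx
        exact ⟨u, A, hd.union_right hx, hp⟩
    · rw [Tm.consMark_unitMark]
      exact ih₂.2.1.count_eq_zero (x := x + 1) hx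
    · simp only [Tm.consMark_unitMark]
      exact ih₂.2.2 (x + 1) u A hx hu
  | get _ ih =>
    exact ⟨fun i D b hD hb => ih.1 i D b hD hb, trivial, fun _ _ _ _ _ => Nat.zero_le _⟩
  | set _ _ _ ih₁ ih₂ =>
    exact ⟨fun i D b hD hb => ⟨ih₁.1 i D b (by simp only [Tm.depth] at hD ⊢; omega) hb,
      ih₂.1 i D b hD hb⟩, ih₂.2.1, ih₂.2.2⟩
  | unfold _ ih => exact ih
  | fold _ ih => exact ih

/-! ### A priori bounds for stratified terms -/

namespace Tm

/-- Each node contributes at most `3 * N`, since deeper levels are cheaper and `box i` at most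
compensates the drop from `node i` to `node (i + 1)`. Only a marked variable at the root level could
cost more, namely `node (δ - 1)`; the disjunction bounds this cost or excludes such an occurrence.
-/
theorem weight_le {w : Weights} {L : Region → ℕ} {D : ℕ} {Q : ℕ → Tm → Prop}
    (hn : Antitone w.node) (hx : ∀ i < D, w.box i * w.node (i + 1) ≤ w.node i)
    {δ : ℕ} {b : ℕ → ℕ} {M : Tm} (h : M.Stratified L D Q δ b) (hb : ∀ x, b x ≤ 1) {N : ℕ}
    (hN : w.node δ ≤ N)
    (hN' : w.node (δ - 1) ≤ N ∨ M.AllOcc fun p x => b x ≠ 0 → p ≠ []) :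
    M.weight w δ b ≤ 3 * M.size * N := by
  induction M generalizing δ b N with
  | var x =>
    simp only [weight, size]
    rcases hN' with h' | h'
    · calc b x * w.node (δ - 1) ≤ 1 * N := Nat.mul_le_mul (hb x) h'
        _ ≤ 3 * 1 * N := by omega
    · have : b x = 0 := by
        by_contra e
        exact h' e rfl
      simp [this]
  | lam M ih =>
    have := ih h.2.2 (fun x => by cases x <;> simp [hb]) hN
      (hN'.imp_right fun h' => AllOcc.mono h' fun p x => by cases x <;> simp [liftOcc])
    simp only [weight, size]
    exact this.trans (Nat.mul_le_mul_right _ (by omega))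
  | app M M' ih₁ ih₂ =>
    have h₁ := ih₁ h.1 hb hN (hN'.imp_right And.left)
    have h₂ := ih₂ h.2 hb hN (hN'.imp_right And.right)
    simp only [weight, size, mul_add, add_mul]
    omega
  | arith _ M M' ih₁ ih₂ =>
    have h₁ := ih₁ h.1 hb hN (hN'.imp_right And.left)
    have h₂ := ih₂ h.2 hb hN (hN'.imp_right And.right)
    simp only [weight, size, mul_add, add_mul]
    omega
  | mod m M ih =>
    cases m with
    | bang =>
      have := ih (N := w.node (δ + 1)) h.2.2.2.2 (fun _ => Nat.zero_le _) le_rfl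
        (Or.inr (allOcc_of_forall (fun _ _ e => absurd rfl e) M))
      simp only [weight]
      split
      · exact Nat.zero_le _
      · calc w.box δ * M.weight w (δ + 1) (fun _ => 0)
            ≤ w.box δ * (3 * M.size * w.node (δ + 1)) := Nat.mul_le_mul_left _ this
          _ = 3 * M.size * (w.box δ * w.node (δ + 1)) := by ring
          _ ≤ 3 * (M.size + 1) * N :=
            Nat.mul_le_mul (by omega) ((hx δ h.1).trans hN)
    | para =>
      have h₁ := ih h.2 hb ((hn δ.le_succ).trans hN) (Or.inl hN)
      have h₂ : M.pending ≤ 1 := by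
        rw [pending]; split <;> omega
      have h₃ := Nat.mul_le_mul h₂ (Nat.mul_le_mul_left 2 hN)
      simp only [weight, size, mul_add, add_mul]
      omega
  | lett m V M ih₁ ih₂ =>
    have h₁ := ih₁ h.2.2.1 hb hN (hN'.imp_right And.left)
    have h₂ := ih₂ h.2.2.2 (fun x => by cases x <;> cases m <;> simp [hb, Modality.mark]) hN
      -- The newly bound variable, if marked, occurs below one modality, hence never at the root.
      (hN'.imp_right fun h' => (h'.2.and h.1).mono fun p x hp => by
        cases x with
        | zero =>
          rintro - rfl
          cases m <;> simpa [Modality.BoundOcc] using hp.2 rfl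
        | succ x => exact hp.1)
    simp only [weight, size, mul_add, add_mul]
    omega
  | set r V ih =>
    have h₁ := ih h.2 hb hN hN'
    simp only [weight, size, mul_add, add_mul]
    omega
  | get r =>
    simp only [weight, size]
    omega
  | regc | unit | int => exact Nat.zero_le _

/-- Box contents are subterms, so a property depending on a size bound can be installed in every box
at once; this starts off the invariant `BoxBound`. -/
theorem Stratified.strengthen {L : Region → ℕ} {D s : ℕ} {Q Q' : ℕ → Tm → Prop}
    (hQ : ∀ δ V, δ < D → V.size ≤ s → V.Stratified L D Q (δ + 1) (fun _ => 0) → Q' δ V)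
    {δ : ℕ} {b : ℕ → ℕ} {M : Tm} (h : M.Stratified L D Q δ b) (hs : M.size ≤ s) :
    M.Stratified L D Q' δ b := by
  induction M generalizing δ b with
  | var x => trivial
  | lam M ih => exact ⟨h.1, h.2.1, ih h.2.2 (by simp only [size] at hs; omega)⟩
  | app M N ih₁ ih₂ =>
    simp only [size] at hs
    exact ⟨ih₁ h.1 (by omega), ih₂ h.2 (by omega)⟩
  | arith _ M N ih₁ ih₂ =>
    simp only [size] at hs
    exact ⟨ih₁ h.1 (by omega), ih₂ h.2 (by omega)⟩
  | mod m M ih =>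
    simp only [size] at hs
    cases m with
    | bang =>
      exact ⟨h.1, h.2.1, h.2.2.1, fun _ => hQ _ _ h.1 (by omega) h.2.2.2.2,
        ih h.2.2.2.2 (by omega)⟩
    | para => exact ⟨h.1, ih h.2 (by omega)⟩
  | lett m V M ih₁ ih₂ =>
    simp only [size] at hs
    exact ⟨h.1, h.2.1, ih₁ h.2.2.1 (by omega), ih₂ h.2.2.2 (by omega)⟩
  | set r V ih => exact ⟨h.1, ih h.2 (by simp only [size] at hs; omega)⟩
  | regc | get => exact h
  | unit | int => trivial

end Tm

/-! ### Potential of configurations and its decrease -/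

/-- The number of modalities of an environment. -/
def Env.level : Env → ℕ
  | [] => 0
  | .arg _ :: E => level E
  | .fn _ :: E => level E
  | .mod _ :: E => level E + 1

/-- The potential of an environment. -/
noncomputable def Env.weight (w : Weights) : Env → ℕ
  | [] => 0
  | .arg V :: E => V.weight w (level E) (fun _ => 0) + w.node (level E) + weight w E
  | .fn M :: E => M.weight w (level E) (fun _ => 0) + 2 * w.node (level E) + weight w E
  | .mod _ :: E => w.node (level E) + weight w E

/-- Stratification of an environment. -/
def Env.Stratified (L : Region → ℕ) (D : ℕ) (Q : ℕ → Tm → Prop) : Env → Prop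
  | [] => True
  | .arg V :: E => V.Stratified L D Q (level E) (fun _ => 0) ∧ Stratified L D Q E
  | .fn M :: E => M.Stratified L D Q (level E) (fun _ => 0) ∧ Stratified L D Q E
  | .mod m :: E => m = .para ∧ level E < D ∧ Stratified L D Q E

/-- The potential of a store. -/
noncomputable def Store.weight (w : Weights) (L : Region → ℕ) (S : Store) : ℕ :=
  (S.map fun e => e.2.weight w (L e.1) fun _ => 0).sum

theorem Store.weight_cons (w : Weights) (L : Region → ℕ) (r : Region) (V : Tm) (S : Store) :
    Store.weight w L ((r, V) ::ₘ S) = V.weight w (L r) (fun _ => 0) + Store.weight w L S := by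
  simp [Store.weight]

/-- The potential of a configuration. -/
noncomputable def Conf.weight (w : Weights) (L : Region → ℕ) (C : Conf) : ℕ :=
  C.term.weight w (Env.level C.env) (fun _ => 0) + Env.weight w C.env + Store.weight w L C.store

/-- Stratification of a configuration. -/
structure Conf.Stratified (L : Region → ℕ) (D : ℕ) (Q : ℕ → Tm → Prop) (C : Conf) : Prop where
  term : C.term.Stratified L D Q (Env.level C.env) fun _ => 0
  env : Env.Stratified L D Q C.env
  store : ∀ e ∈ C.store, e.2.Stratified L D Q (L e.1) fun _ => 0

theorem Env.Stratified.mono {L : Region → ℕ} {D : ℕ} {Q Q' : ℕ → Tm → Prop} {E : Env}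
    (h : Env.Stratified L D Q E) (hQ : ∀ δ V, Q δ V → Q' δ V) : Env.Stratified L D Q' E := by
  induction E with
  | nil => trivial
  | cons F E ih =>
    cases F with
    | arg V => exact ⟨h.1.mono hQ, ih h.2⟩
    | fn M => exact ⟨h.1.mono hQ, ih h.2⟩
    | mod m => exact ⟨h.1, h.2.1, ih h.2.2⟩

theorem Conf.Stratified.mono_bound {w : Weights} {Z c c' : ℕ} {L : Region → ℕ} {D : ℕ} {C : Conf}
    (h : C.Stratified L D (Tm.BoxBound w Z c)) (hc : c' ≤ c) :
    C.Stratified L D (Tm.BoxBound w Z c') where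
  term := h.term.mono_bound hc
  env := h.env.mono fun _ _ hV => le_trans (Nat.add_le_add_left hc _) hV
  store e he := (h.store e he).mono_bound hc

/-- Every step consumes at least one unit `node` at some level, and substitution creates no
potential. Store access only moves a value, at the same level, so the choice of the value read is
irrelevant. -/
theorem Step.weight_lt {w : Weights} {Z : ℕ} {L : Region → ℕ} {D : ℕ}
    (hpos : ∀ i, 0 < w.node i) (hbox : ∀ i < D, 0 < w.box i)
    (hZ : ∀ i < D, Z ≤ w.box i * w.node i) {C C' : Conf} (hs : Step C C')
    (h : C.Stratified L D (Tm.BoxBound w Z (C.weight w L))) :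
    C'.weight w L < C.weight w L ∧ C'.Stratified L D (Tm.BoxBound w Z (C'.weight w L)) := by
  have hb0 : consMark Modality.para.mark (fun _ => 0) = fun _ => 0 := consMark_const_zero
  suffices hsuff : C'.weight w L < C.weight w L ∧ (C'.weight w L < C.weight w L →
      C'.Stratified L D (Tm.BoxBound w Z (C'.weight w L))) from ⟨hsuff.1, hsuff.2 hsuff.1⟩
  obtain ⟨ht, he, hst⟩ := h
  have hnode := hpos (Env.level C.env)
  cases hs with
  | arith op a b E S =>
    refine ⟨?_, fun hlt => Conf.Stratified.mono_bound ⟨trivial, he, hst⟩ hlt.le⟩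
    simp only [Conf.weight, Tm.weight] at *
    omega
  | beta M V E S hV =>
    have hocc : M.AllOcc fun p x =>
        x = 0 → (∀ m ∈ p, m = .para) ∧ Env.level E + p.length = Env.level E :=
      ht.1.mono fun p x hx e => by simp [hx e]
    have hr := Tm.replaces_single 0 V
    have hw := Tm.weight_subst w hV hr hocc
    simp only [consMark_const_zero, zero_mul, mul_zero, add_zero] at hw
    have hM := ht.2.2
    rw [consMark_const_zero] at hM hr
    refine ⟨?_, fun hlt => Conf.Stratified.mono_bound
      ⟨Tm.Stratified.subst hV hr he.1 hocc hM, he.2, hst⟩ hlt.le⟩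
    -- By linearity at most one copy of `V` appears, and its potential was already counted in the
    -- frame.
    have := Nat.mul_le_mul_right (V.weight w (Env.level E) fun _ => 0) ht.2.1
    simp only [Conf.weight, Tm.weight, Env.weight, Env.level, Tm.inst, consMark_const_zero] at *
    omega
  | app M N E S =>
    refine ⟨?_, fun hlt => Conf.Stratified.mono_bound ⟨ht.2, ⟨ht.1, he⟩, hst⟩ hlt.le⟩
    simp only [Conf.weight, Tm.weight, Env.weight, Env.level] at *
    omega
  | swap V M E S hV =>
    refine ⟨?_, fun hlt => Conf.Stratified.mono_bound ⟨he.1, ⟨ht, he.2⟩, hst⟩ hlt.le⟩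
    simp only [Conf.weight, Env.weight, Env.level] at *
    omega
  | enter m M E S hM =>
    cases m with
    -- Stratified `!`-boxes contain values, so the machine never evaluates under `!`.
    | bang => exact absurd ht.2.1 hM
    | para =>
      refine ⟨?_, fun hlt => Conf.Stratified.mono_bound ⟨ht.2, ⟨rfl, ht.1, he⟩, hst⟩ hlt.le⟩
      simp only [Conf.weight, Tm.weight, Env.weight, Env.level,
        Tm.pending_of_not_isValue hM] at *
      omega
  | leave m V E S hV =>
    obtain ⟨rfl, hD, he⟩ := he
    refine ⟨?_, fun hlt => Conf.Stratified.mono_bound ⟨⟨hD, ht⟩, he, hst⟩ hlt.le⟩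
    have := hpos (Env.level E)
    simp only [Conf.weight, Tm.weight, Env.weight, Env.level, Tm.pending_of_isValue hV] at *
    omega
  | lett m V M E S hV =>
    obtain ⟨hocc, hlin, hVs, hM⟩ := ht
    cases m with
    | para =>
      have hocc' : M.AllOcc fun p x =>
          x = 0 → (∀ m ∈ p, m = .para) ∧ Env.level E + p.length = Env.level E + 1 :=
        hocc.mono fun p x hx e => by
          have : p = [.para] := hx e
          simp [this]
      have hr := Tm.replaces_single 0 V
      have hw := Tm.weight_subst w hV hr hocc'
      simp only [consMark_const_zero, zero_mul, mul_zero, add_zero] at hw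
      rw [hb0] at hM
      rw [consMark_const_zero] at hr
      refine ⟨?_, fun hlt => Conf.Stratified.mono_bound
        ⟨Tm.Stratified.subst hV hr hVs.2 hocc' hM, he, hst⟩ hlt.le⟩
      have := Nat.mul_le_mul_right (V.weight w (Env.level E + 1) fun _ => 0) (hlin rfl)
      simp only [Conf.weight, Tm.weight, Tm.inst, hb0, Tm.pending_of_isValue hV] at *
      omega
    | bang =>
      obtain ⟨hD, -, -, hQ, hVs⟩ := hVs
      have hVb := hQ (Tm.count_zero V)
      -- `BoxBound` and `hZ` give `box * weight ≤ Z` and `Z` itself lies below or at `box * node`;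
      -- cancelling `box` shows that the prepayment covers each copy.
      have hVw : V.weight w (Env.level E + 1) (fun _ => 0) ≤ w.node (Env.level E) := by
        refine Nat.le_of_mul_le_mul_left ?_ (hbox _ hD)
        rw [Tm.BoxBound] at hVb
        have := hZ _ hD
        simp only at hVb this ⊢
        omega
      have hw := Tm.Stratified.subst_box hV (Tm.replaces_single 1 V) rfl hVs hVb hVw hocc hM
      have hlt : Conf.weight w L ⟨M.inst V, E, S⟩ <
          Conf.weight w L ⟨.lett .bang (.mod .bang V) M, E, S⟩ := by
        have h₁ := hw.1
        simp only [Conf.weight, Tm.weight, Tm.inst, Modality.mark] at *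
        omega
      refine ⟨hlt, fun _ => ⟨hw.2 _ ?_, (he.mono fun _ _ hV =>
        le_trans (Nat.add_le_add_left hlt.le _) hV), fun e he => (hst e he).mono_bound hlt.le⟩⟩
      simp only [Conf.weight, Tm.weight, Tm.inst, Modality.mark] at *
      omega
  | get r V E S =>
    have hV := hst _ (Multiset.mem_cons_self _ _)
    have hL : L r = Env.level E := ht
    refine ⟨?_, fun hlt => Conf.Stratified.mono_bound
      ⟨by simpa only [hL] using hV, he, fun e hmem => hst e (Multiset.mem_cons_of_mem hmem)⟩
      hlt.le⟩
    simp only [Conf.weight, Tm.weight, Store.weight_cons, hL] at *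
    omega
  | set r V E S hV =>
    have hL : L r = Env.level E := ht.1
    refine ⟨?_, fun hlt => Conf.Stratified.mono_bound ⟨trivial, he, fun e hmem => ?_⟩ hlt.le⟩
    · simp only [Conf.weight, Tm.weight, Store.weight_cons, hL] at *
      omega
    · rcases Multiset.mem_cons.1 hmem with rfl | hmem
      · simp only [hL]
        exact ht.2
      · exact hst e hmem

theorem Steps.add_weight_le {w : Weights} {Z : ℕ} {L : Region → ℕ} {D : ℕ}
    (hpos : ∀ i, 0 < w.node i) (hbox : ∀ i < D, 0 < w.box i)
    (hZ : ∀ i < D, Z ≤ w.box i * w.node i) {n : ℕ} {C C' : Conf} (hs : Steps n C C')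
    (h : C.Stratified L D (Tm.BoxBound w Z (C.weight w L))) :
    n + C'.weight w L ≤ C.weight w L := by
  induction hs with
  | refl C => simp
  | head hs _ ih =>
    have := hs.weight_lt hpos hbox hZ h
    have := ih this.2
    omega

/-- A run that has not reached a final configuration can be prolonged, which a uniform bound allows
only finitely often. -/
theorem terminatesWithin_of_forall_le {C : Conf} {N : ℕ}
    (h : ∀ (n : ℕ) (C' : Conf), Steps n C C' → n ≤ N) : TerminatesWithin C N := by
  refine ⟨h, ?_⟩
  induction N generalizing C with
  | zero => exact ⟨0, C, .refl C, fun C' hs => by simpa using h _ _ (.head hs (.refl C'))⟩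
  | succ N ih =>
    by_cases hC : C.IsFinal
    · exact ⟨0, C, .refl C, hC⟩
    · simp only [Conf.IsFinal, not_forall, not_not] at hC
      obtain ⟨C₁, hs⟩ := hC
      obtain ⟨n, C', hn, hfin⟩ := ih fun n C' hn => by
        have := h _ _ (.head hs hn)
        omega
      exact ⟨n + 1, C', .head hs hn, hfin⟩

/-! ### Choice of the coefficients and the polynomial bound -/

/-- The coefficients for terms of depth `d`, where `a` is a multiple of the size. -/
def Weights.ofDepth (a d : ℕ) : Weights where
  node i := a ^ (2 ^ d - 2 ^ i)
  box i := a ^ 2 ^ i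

theorem Weights.antitone_ofDepth {a : ℕ} (ha : 0 < a) (d : ℕ) : Antitone (ofDepth a d).node :=
  fun _ _ hij => Nat.pow_le_pow_right ha
    (Nat.sub_le_sub_left (Nat.pow_le_pow_right two_pos hij) _)

theorem Weights.box_mul_node {a d i : ℕ} (hi : i < d) :
    (ofDepth a d).box i * (ofDepth a d).node i = a ^ 2 ^ d := by
  have := Nat.pow_le_pow_right two_pos hi.le
  simp only [ofDepth]
  rw [← pow_add]
  congr 1
  omega

/-- The exponents double from level to level because this needs `2 ^ i + (2 ^ d - 2 ^ (i + 1)) = 2 ^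
d - 2 ^ i`. -/
theorem Weights.box_mul_node_succ {a d i : ℕ} (hi : i < d) :
    (ofDepth a d).box i * (ofDepth a d).node (i + 1) = (ofDepth a d).node i := by
  have := Nat.pow_le_pow_right two_pos (Nat.succ_le_of_lt hi)
  simp only [ofDepth]
  rw [← pow_add]
  congr 1
  rw [Nat.succ_eq_add_one, pow_succ] at this
  rw [pow_succ]
  omega

theorem WellTyped.terminatesWithin {M : Tm} (hM : WellTyped M) :
    TerminatesWithin (Conf.init M) ((6 * M.size) ^ 2 ^ M.depth) := by
  obtain ⟨R, Γ, δ, A, -, hT, -⟩ := hM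
  set L := R.level (0 + δ)
  set d := M.depth
  set s := M.size
  have hs : 0 < 6 * s := by have := M.size_pos; omega
  set w := Weights.ofDepth (6 * s) d
  have hn : Antitone w.node := Weights.antitone_ofDepth hs d
  have hx : ∀ i < d, w.box i * w.node (i + 1) ≤ w.node i :=
    fun i hi => (Weights.box_mul_node_succ hi).le
  have hst : M.Stratified L d (fun _ _ => True) 0 fun _ => 0 :=
    hT.stratified.1 0 d _ (by simp [d]) fun _ => Nat.zero_le _
  have hle : ∀ (i : ℕ) (V : Tm), V.Stratified L d (fun _ _ => True) i (fun _ => 0) →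
      V.weight w i (fun _ => 0) ≤ 3 * V.size * w.node i := fun i V hV =>
    Tm.weight_le hn hx hV (fun _ => Nat.zero_le _) le_rfl
      (Or.inr (Tm.allOcc_of_forall (fun _ _ e => absurd rfl e) V))
  -- The factor `6` splits `Z` into two halves `3 * s * node 0`: one bounds the initial potential,
  -- the other the weighted contents of any box.
  have hZ : (6 * s) ^ 2 ^ d = 6 * s * w.node 0 := by
    simp only [w, Weights.ofDepth]
    rw [← pow_succ']
    congr 1
    have := Nat.pow_le_pow_right two_pos (Nat.zero_le d)
    omega
  have hinit : (Conf.init M).weight w L ≤ 3 * s * w.node 0 := by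
    have := hle 0 M hst
    simpa [Conf.weight, Conf.init, Env.level, Env.weight, Store.weight] using this
  have hstrat : (Conf.init M).Stratified L d
      (Tm.BoxBound w ((6 * s) ^ 2 ^ d) ((Conf.init M).weight w L)) := by
    refine ⟨Tm.Stratified.strengthen (s := s) (fun i V hi hVs hV => ?_) hst le_rfl, trivial,
      fun e he => by simp [Conf.init] at he⟩
    rw [Tm.BoxBound, hZ]
    have : w.box i * V.weight w (i + 1) (fun _ => 0) ≤ 3 * s * w.node 0 :=
      calc w.box i * V.weight w (i + 1) (fun _ => 0)
          ≤ w.box i * (3 * V.size * w.node (i + 1)) := Nat.mul_le_mul_left _ (hle _ V hV)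
        _ = 3 * V.size * (w.box i * w.node (i + 1)) := by ring
        _ ≤ 3 * s * w.node 0 :=
          Nat.mul_le_mul (Nat.mul_le_mul_left 3 hVs) ((hx i hi).trans (hn (Nat.zero_le i)))
    calc _ ≤ 3 * s * w.node 0 + 3 * s * w.node 0 := Nat.add_le_add this hinit
      _ = 6 * s * w.node 0 := by ring
  refine terminatesWithin_of_forall_le fun n C' hsteps => ?_
  have := hsteps.add_weight_le (w := w) (fun i => pow_pos hs _) (fun i _ => pow_pos hs _)
    (fun i hi => (Weights.box_mul_node hi).ge) hstrat
  calc n ≤ (Conf.init M).weight w L := (Nat.le_add_right _ _).trans this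
    _ ≤ 3 * s * w.node 0 := hinit
    _ ≤ 6 * s * w.node 0 := Nat.mul_le_mul_right _ (by omega)
    _ = _ := hZ.symm

end LALReg

theorem theorem1 :
    ∃ P : ℕ → Polynomial ℕ, ∀ M : LALReg.Tm, LALReg.WellTyped M →
      LALReg.TerminatesWithin (LALReg.Conf.init M) ((P M.depth).eval M.size) := by
  refine ⟨fun d => (6 * Polynomial.X) ^ 2 ^ d, fun M hM => ?_⟩
  simpa using hM.terminatesWithin
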